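/- **Setting.** Let $m\ge 1$, let $d_1,\dots,d_m$ be positive integers, $d=\sum_\nu d_\nu$, let $j_1,\dots,j_m\in\mathbb R$ and $\varepsilon_1,\dots,\varepsilon_m>0$. For each $\nu$ let $A_\nu\in\mathbb R^{d_\nu\times d_\nu}$ be a diagonal matrix with diagonal entries in $[d\,2^{-j_\nu},\,d\,2^{-j_\nu+1}]$, and suppose $\sum_\nu \operatorname{Tr}A_\nu=d$. $\mathrm{GOE}(d')$ is the law of the symmetric $d'\times d'$ real matrix $G$ whose entries on and above the diagonal are independent, the diagonal ones $\mathcal N(0,2/d')$ and the others $\mathcal N(0,1/d')$; $\mathrm{GOE}^*(d')$ is the law of $G-\frac{\operatorname{Tr}G}{d'}I$. For a constant $C>0$ let $$U_\nu=\Bigl\{M\in\mathbb R^{d_\nu\times d_\nu}:\ \|M\|_{\mathrm{op}}\le 3+C\sqrt{\log(m)/d_\nu},\ \ \|M\|_1\ge d_\nu/12\Bigr\},$$ where $\|\cdot\|_1$ is the trace norm, and let $\overline M_1,\dots,\overline M_m$ be independent, $\overline M_\nu$ having the law $\mathrm{GOE}^*(d_\nu)$ conditioned on $U_\nu$. Consider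 the hypotheses $$H_0:\ \rho=\tfrac1d\operatorname{diag}(A_1,\dots,A_m),\qquad H_1:\ \rho=\tfrac1d\operatorname{diag}(A_1+\varepsilon_1\overline M_1,\dots,A_m+\varepsilon_m\overline M_m),$$ where the $\overline M_\nu$ in $H_1$ are drawn once and all copies are in the same state $\rho$. An algorithm using $n$ incoherent measurements measures $n$ copies of $\rho$ one at a time, each with a POVM with finitely many outcomes on $\mathbb C^d$ (outcome $z$ of $\{M_z\}$ has probability $\operatorname{Tr}(\rho M_z)$) that may depend on the earlier outcomes, and then outputs $H_0$ or $H_1$ as a function of all $n$ outcomes. It distinguishes $H_0$ from $H_1$ with success probability at least $2/3$ if it outputs $H_i$ with probability at least $2/3$ under $H_i$, for both $i=0,1$ (under $H_1$ the probability is also over the $\overline M_\nu$). **Theorem.** There are absolute constants $a^*,k\in\mathbb N$ and $C,C',c>0$ such that the following holds for all data as above. Let $$\varepsilon=\frac1d\sum_\nu d_\nu\varepsilon_\nu,\qquad N=\frac1m\min_{\nu}\frac{d_\nu^{1/2}d^2}{\varepsilon_\nu^2\,2^{j_\nu}}.$$ If $N\ge 1/\varepsilon$ and, for every $\nu$, $$d_\nu\ge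 a^*,\qquad \varepsilon_\nu\le \frac{d\,2^{-j_\nu}}{12+C'\sqrt{\log(m)/d_\nu}},\qquad \frac{d_\nu}{2^{j_\nu}}\ge\frac{2\varepsilon}{\log(d/\varepsilon)},$$ then every algorithm that distinguishes $H_0$ from $H_1$ with $n$ incoherent measurements with success probability at least $2/3$ satisfies $$n\ \ge\ \frac{c\,N}{\log^{k}(N+2)}\qquad\bigl(\text{that is, } n=\widetilde\Omega(N)\bigr).$$ -/

import Mathlib

open MeasureTheory ProbabilityTheory
open scoped NNReal ENNReal ComplexOrder

namespace BlockTask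

noncomputable section

/-! ### Incoherent measurements -/

/-- A positive operator valued measurement on `ℂ^ι` with finitely many outcomes `0, …, r - 1`. -/
structure POVM (ι : Type) [Fintype ι] [DecidableEq ι] (r : ℕ) where
  elem : Fin r → Matrix ι ι ℂ
  posSemidef : ∀ z, (elem z).PosSemidef
  sum_eq_one : ∑ z, elem z = 1

/-- An algorithm using exactly `n` incoherent, possibly adaptive, measurements on states over
`ℂ^ι`: a decision tree of depth `n`. At every internal node a fresh copy of the state is measured
with a POVM, and the outcome selects the child; every leaf carries a decision (`false` stands for
the null hypothesis, `true` for the alternative). The POVM at a node may depend on all previous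
outcomes. -/
inductive IncoherentAlgorithm (ι : Type) [Fintype ι] [DecidableEq ι] : ℕ → Type
  | leaf (decision : Bool) : IncoherentAlgorithm ι 0
  | node {n r : ℕ} (M : POVM ι r) (next : Fin r → IncoherentAlgorithm ι n) :
      IncoherentAlgorithm ι (n + 1)

/-- The probability that the algorithm decides `b` when every copy is in the state `ρ`: outcome `z`
of a POVM `M` has probability `Tr (ρ M_z)`. -/
def IncoherentAlgorithm.decisionProb {ι : Type} [Fintype ι] [DecidableEq ι]
    (ρ : Matrix ι ι ℂ) (b : Bool) : {n : ℕ} → IncoherentAlgorithm ι n → ℝ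
  | _, .leaf decision => if decision = b then 1 else 0
  | _, .node M next => ∑ z, (Matrix.trace (ρ * M.elem z)).re * (next z).decisionProb ρ b

/-! ### The trace-centered Gaussian orthogonal ensemble and its truncations -/

/-- Matrices carry the product (Borel) sigma-algebra. -/
instance instMeasurableSpaceMatrix {p q : Type*} :
    MeasurableSpace (Matrix p q ℝ) :=
  inferInstanceAs (MeasurableSpace (p → q → ℝ))

/-- `GOE(d)`: the law of the symmetric matrix whose entries on and above the diagonal are
independent, the diagonal ones `N(0, 2/d)` and those above the diagonal `N(0, 1/d)`. It is obtained
from an array of independent variables by reflecting its upper triangle. -/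
def goe (d : ℕ) : Measure (Matrix (Fin d) (Fin d) ℝ) :=
  (Measure.pi fun i : Fin d => Measure.pi fun j : Fin d =>
      gaussianReal 0 (if i = j then 2 / (d : ℝ≥0) else 1 / (d : ℝ≥0))).map
    fun W => Matrix.of fun i j => W (min i j) (max i j)

/-- `GOE*(d)`: the law of `G - (Tr G / d) I` for `G ∼ GOE(d)`. -/
def goeStar (d : ℕ) : Measure (Matrix (Fin d) (Fin d) ℝ) :=
  (goe d).map fun G => G - (G.trace / (d : ℝ)) • (1 : Matrix (Fin d) (Fin d) ℝ)

/-- `GOE*_U(d)`: the law `GOE*(d)` conditioned on the event `U`. -/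
def goeStarTrunc (d : ℕ) (U : Set (Matrix (Fin d) (Fin d) ℝ)) :
    Measure (Matrix (Fin d) (Fin d) ℝ) :=
  ProbabilityTheory.cond (goeStar d) U

/-- The operator norm (largest singular value) of a real square matrix. -/
def opNorm {d : ℕ} (M : Matrix (Fin d) (Fin d) ℝ) : ℝ :=
  ‖Matrix.toEuclideanCLM (𝕜 := ℝ) M‖

/-- The trace norm (sum of the singular values) of a real square matrix. -/
def traceNorm {d : ℕ} (M : Matrix (Fin d) (Fin d) ℝ) : ℝ :=
  ∑ i, √((Matrix.isHermitian_conjTranspose_mul_self M).eigenvalues i)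

/-- The truncation event for a block of size `d` in a task with `m` blocks: operator norm at most
`3 + C √(log m / d)` and trace norm at least `d / 12`. -/
def truncEvent (C : ℝ) (m d : ℕ) : Set (Matrix (Fin d) (Fin d) ℝ) :=
  {M | opNorm M ≤ 3 + C * √(Real.log m / d) ∧ (d : ℝ) / 12 ≤ traceNorm M}

/-! ### The multi-block distinguishing task -/

/-- The data of the task: `m ≥ 1` blocks of sizes `dim ν`, bucket exponents `j ν`, the diagonals
`a ν` of the blocks `A_ν`, and the perturbation strengths `eps ν`. -/
structure Task (m : ℕ) where
  one_le_m : 1 ≤ m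
  dim : Fin m → ℕ
  j : Fin m → ℝ
  a : (ν : Fin m) → Fin (dim ν) → ℝ
  eps : Fin m → ℝ
  eps_pos : ∀ ν, 0 < eps ν
  /-- The entries of `A_ν` lie in `[d 2^{-j_ν}, d 2^{-j_ν+1}]`, where `d` is the total dimension. -/
  a_mem : ∀ ν i, a ν i ∈
    Set.Icc (((∑ μ, dim μ : ℕ) : ℝ) * (2 : ℝ) ^ (-j ν))
      (((∑ μ, dim μ : ℕ) : ℝ) * (2 : ℝ) ^ (-j ν + 1))
  /-- `∑_ν Tr A_ν = d`. -/
  sum_a : ∑ ν, ∑ i, a ν i = ((∑ μ, dim μ : ℕ) : ℝ)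

namespace Task

variable {m : ℕ} (T : Task m)

/-- The row and column indices of the state; the `ν`-th fibre indexes the `ν`-th block. -/
abbrev Index : Type := (ν : Fin m) × Fin (T.dim ν)

/-- The total dimension `d = ∑_ν d_ν`. -/
def d : ℕ := ∑ ν, T.dim ν

/-- `ε = (1/d) ∑_ν d_ν ε_ν`. -/
def epsTotal : ℝ := (1 / (T.d : ℝ)) * ∑ ν, (T.dim ν : ℝ) * T.eps ν

/-- `N = (1/m) min_ν d_ν^{1/2} d² / (ε_ν² 2^{j_ν})`. -/
def N : ℝ :=
  (1 / (m : ℝ)) * ⨅ ν, √(T.dim ν : ℝ) * (T.d : ℝ) ^ 2 / (T.eps ν ^ 2 * (2 : ℝ) ^ T.j ν)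

/-- The state `(1/d) diag(A_1 + ε_1 M_1, …, A_m + ε_m M_m)`. -/
def perturbedState (M : (ν : Fin m) → Matrix (Fin (T.dim ν)) (Fin (T.dim ν)) ℝ) :
    Matrix T.Index T.Index ℂ :=
  ((1 / (T.d : ℝ)) • Matrix.blockDiagonal' fun ν =>
    Matrix.diagonal (T.a ν) + T.eps ν • M ν).map Complex.ofReal

/-- The null state `(1/d) diag(A_1, …, A_m)`. -/
def nullState : Matrix T.Index T.Index ℂ :=
  ((1 / (T.d : ℝ)) • Matrix.blockDiagonal' fun ν =>
    Matrix.diagonal (T.a ν)).map Complex.ofReal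

/-- The law of the independent perturbations `M_ν ∼ GOE*_{U_ν}(d_ν)`, where `U_ν` is the truncation
event with constant `C`. -/
def perturbationLaw (C : ℝ) :
    Measure ((ν : Fin m) → Matrix (Fin (T.dim ν)) (Fin (T.dim ν)) ℝ) :=
  Measure.pi fun ν => goeStarTrunc (T.dim ν) (truncEvent C m (T.dim ν))

/-- The algorithm distinguishes `H₀` (the null state) from `H₁` (a random perturbed state, drawn
once and then copied) with success probability at least `2/3` under either hypothesis. -/
def Distinguishes (C : ℝ) {n : ℕ} (alg : IncoherentAlgorithm T.Index n) : Prop :=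
  2 / 3 ≤ alg.decisionProb T.nullState false ∧
  2 / 3 ≤ ∫ M, alg.decisionProb (T.perturbedState M) true ∂(T.perturbationLaw C)

end Task

end

end BlockTask

/-! The bound comes from a hybrid over blocks and, within one block, an entropy argument along the
decision tree. It gives `n > N / 200`, with no logarithmic loss.

One block. Fix the other blocks at admissible values and compare a random perturbation of block `ν`
with no perturbation. At a node of the tree the unnormalised posterior of the perturbation is a
weight `W`, the product of the outcome probabilities so far. Two quantities are followed: the
relative entropy of the transcript law with respect to the reference law, and the entropy of the
posterior with respect to the prior. A measurement increases the first by at most the chi-square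
deviation of the posterior-mean outcome law, and the second by at most the posterior mean of the
chi-square deviation. Both are quadratic in the perturbation, and since the prior is sub-Gaussian,
the Donsker-Varadhan inequality bounds them by the entropy of the posterior: the first by `α` times
the entropy, the second by `2α` times the entropy plus a constant `β`. The entropy starts at zero,
so it grows like `β n` and the relative entropy like `α β n²`. This is `StepBound` with
`StepBound.decisionProb_le_aux`.

The size of `α` and `β`. For effects `F_z` summing to the identity, the vectors `F_z / √(Tr F_z)`
have synthesis operator of norm at most one (`norm_sum_scaledVec_le`), while the sum of their
squared norms is only bounded by the dimension `d_ν` (`sum_norm_scaledVec_le`). With sub-Gaussian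
constant `2 / d_ν` this yields `β` of order `strength ν` and `α` of order `strength ν / d_ν`: a
linear functional of the posterior gains a factor `d_ν` over a typical quadratic one. Hence `α β n²`
is of order `(n strength ν)² / d_ν`, which is where `√d_ν` in `N` comes from.

The prior. For `d ≥ 50` the truncation event has probability at least one half: the operator norm is
bounded by exponential moments averaged over the unit ball, the Frobenius norm by a Chernoff bound.
Conditioning then at most doubles the density, and the symmetry `M ↦ -M` turns this into a doubling
of the sub-Gaussian constant (`isSubGaussian_goeStarTrunc`).

Hybrid. If `n ≤ N / 200`, each block costs at most `1 / (6 m)` in acceptance probability, so all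
blocks cost at most `1 / 6`; acceptance under `H₁` is at most `1 / 3 + 1 / 6 < 2 / 3`. -/

namespace BlockTask

noncomputable section

/-! ### Entropy of posteriors and its change under one measurement -/

section Entropy

variable {X : Type*} [MeasurableSpace X] {μ : Measure X}

/-- A weight with values in `[0, 1]`, the density of an unnormalised posterior. -/
structure IsWeight (μ : Measure X) (W : X → ℝ) : Prop where
  measurable : Measurable W
  nonneg : ∀ᵐ x ∂μ, 0 ≤ W x
  le_one : ∀ᵐ x ∂μ, W x ≤ 1

/-- The entropy `∫ W log W - (∫ W) log (∫ W)` of a weight. -/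
def entropy (μ : Measure X) (W : X → ℝ) : ℝ :=
  ∫ x, W x * Real.log (W x) ∂μ - (∫ x, W x ∂μ) * Real.log (∫ x, W x ∂μ)

theorem abs_mul_log_le_one {t : ℝ} (h0 : 0 ≤ t) (h1 : t ≤ 1) : |t * Real.log t| ≤ 1 := by
  rcases h0.eq_or_lt with rfl | h0
  · simp
  have := Real.log_le_sub_one_of_pos (inv_pos.2 h0)
  rw [Real.log_inv] at this
  have hl : Real.log t ≤ 0 := Real.log_nonpos h0.le h1
  rw [abs_of_nonpos (mul_nonpos_of_nonneg_of_nonpos h0.le hl)]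
  have := mul_le_mul_of_nonneg_left this h0.le
  rw [mul_sub, mul_inv_cancel₀ h0.ne'] at this
  linarith

namespace IsWeight

variable {W : X → ℝ}

theorem integrable [IsFiniteMeasure μ] (hW : IsWeight μ W) : Integrable W μ :=
  Integrable.of_bound hW.measurable.aestronglyMeasurable 1 <| by
    filter_upwards [hW.nonneg, hW.le_one] with x h0 h1
    rwa [Real.norm_eq_abs, abs_of_nonneg h0]

theorem integrable_mul [IsFiniteMeasure μ] (hW : IsWeight μ W) {f : X → ℝ} (hf : Measurable f)
    {K : ℝ} (hK : ∀ᵐ x ∂μ, |f x| ≤ K) : Integrable (fun x => W x * f x) μ :=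
  Integrable.of_bound (hW.measurable.mul hf).aestronglyMeasurable K <| by
    filter_upwards [hW.nonneg, hW.le_one, hK] with x h0 h1 hk
    rw [Real.norm_eq_abs, abs_mul, abs_of_nonneg h0]
    nlinarith [abs_nonneg (f x)]

theorem integrable_mul_log [IsFiniteMeasure μ] (hW : IsWeight μ W) :
    Integrable (fun x => W x * Real.log (W x)) μ :=
  Integrable.of_bound
    (hW.measurable.mul (Real.measurable_log.comp hW.measurable)).aestronglyMeasurable 1 <| by
    filter_upwards [hW.nonneg, hW.le_one] with x h0 h1
    exact abs_mul_log_le_one h0 h1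

theorem integral_nonneg (hW : IsWeight μ W) : 0 ≤ ∫ x, W x ∂μ :=
  integral_nonneg_of_ae hW.nonneg

theorem mul (hW : IsWeight μ W) {π : X → ℝ} (hm : Measurable π) (h0 : ∀ᵐ x ∂μ, 0 ≤ π x)
    (h1 : ∀ᵐ x ∂μ, π x ≤ 1) : IsWeight μ fun x => W x * π x where
  measurable := hW.measurable.mul hm
  nonneg := by filter_upwards [hW.nonneg, h0] with x a b using mul_nonneg a b
  le_one := by
    filter_upwards [hW.le_one, h0, h1] with x a b c using mul_le_one₀ a b c

theorem ae_eq_zero [IsFiniteMeasure μ] (hW : IsWeight μ W) (h : ∫ x, W x ∂μ = 0) :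
    ∀ᵐ x ∂μ, W x = 0 := by
  have := (integral_eq_zero_iff_of_nonneg_ae hW.nonneg hW.integrable).1 h
  filter_upwards [this] with x hx using hx

/-- The Donsker-Varadhan inequality. -/
theorem integral_mul_le [IsProbabilityMeasure μ] (hW : IsWeight μ W) {f : X → ℝ}
    (hf : Measurable f) {K : ℝ} (hK : ∀ᵐ x ∂μ, |f x| ≤ K) {c : ℝ}
    (hc : ∫ x, Real.exp (f x) ∂μ ≤ Real.exp c) :
    ∫ x, W x * f x ∂μ ≤ entropy μ W + (∫ x, W x ∂μ) * c := by
  set p := ∫ x, W x ∂μ with hp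
  have hp0 : 0 ≤ p := hW.integral_nonneg
  rcases hp0.eq_or_lt with h0 | hpos
  · have hz := hW.ae_eq_zero h0.symm
    have e1 : ∫ x, W x * f x ∂μ = 0 := by
      rw [integral_congr_ae (g := fun _ => (0 : ℝ))]
      · simp
      · filter_upwards [hz] with x hx; simp [hx]
    have e2 : ∫ x, W x * Real.log (W x) ∂μ = 0 := by
      rw [integral_congr_ae (g := fun _ => (0 : ℝ))]
      · simp
      · filter_upwards [hz] with x hx; simp [hx]
    rw [e1, entropy, e2, ← hp, ← h0]; simp
  have hexp : Integrable (fun x => Real.exp (f x)) μ :=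
    Integrable.of_bound (Real.measurable_exp.comp hf).aestronglyMeasurable (Real.exp K) <| by
      filter_upwards [hK] with x hx
      rw [Real.norm_eq_abs, abs_of_pos (Real.exp_pos _)]
      exact Real.exp_le_exp.2 ((le_abs_self _).trans hx)
  -- Pointwise Fenchel inequality: `1 + y ≤ exp y` at `y = f - c + log p - log W`, multiplied by
  -- `W`. The two corrections `- W` and `p exp (f - c)` integrate to at most zero.
  have key : ∀ᵐ x ∂μ, W x * f x ≤ W x * Real.log (W x) - W x * Real.log p + W x * c - W x
      + p * Real.exp (-c) * Real.exp (f x) := by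
    filter_upwards [hW.nonneg] with x hx
    rcases hx.eq_or_lt with h | h
    · rw [← h]; simp; positivity
    · have h1 := Real.add_one_le_exp (f x - c + Real.log p - Real.log (W x))
      have h2 : Real.exp (f x - c + Real.log p - Real.log (W x))
          = Real.exp (-c) * Real.exp (f x) * p / W x := by
        rw [Real.exp_sub, Real.exp_add, Real.exp_log hpos, Real.exp_log h, sub_eq_add_neg,
          Real.exp_add]; ring
      rw [h2] at h1
      have h3 := mul_le_mul_of_nonneg_left h1 h.le
      rw [mul_div_cancel₀ _ h.ne'] at h3
      nlinarith
  have hI := hW.integrable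
  have i1 := hW.integrable_mul_log
  have i2 : Integrable (fun x => W x * Real.log p) μ := hI.mul_const _
  have i3 : Integrable (fun x => W x * c) μ := hI.mul_const _
  have i4 : Integrable (fun x => p * Real.exp (-c) * Real.exp (f x)) μ := hexp.const_mul _
  have := integral_mono_ae (hW.integrable_mul hf hK)
    ((((i1.sub i2).add i3).sub hI).add i4) key
  rw [integral_add' (((i1.sub i2).add i3).sub hI) i4, integral_sub' ((i1.sub i2).add i3) hI,
    integral_add' (i1.sub i2) i3, integral_sub' i1 i2, integral_mul_const, integral_mul_const,
    integral_const_mul, ← hp] at this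
  have h5 : p * Real.exp (-c) * ∫ x, Real.exp (f x) ∂μ ≤ p := by
    calc _ ≤ p * Real.exp (-c) * Real.exp c := by gcongr
      _ = p := by rw [mul_assoc, ← Real.exp_add]; simp
  rw [entropy, ← hp]; linarith

theorem entropy_nonneg [IsProbabilityMeasure μ] (hW : IsWeight μ W) : 0 ≤ entropy μ W := by
  have := hW.integral_mul_le (f := fun _ => 0) measurable_const (K := 0) (by simp) (c := 0)
    (by simp)
  simpa using this

end IsWeight

/-- One measurement: the outcome probabilities `π z x` under the parameter `x` and `p z` under the
reference state. -/
structure Outcomes (μ : Measure X) {r : ℕ} (π : Fin r → X → ℝ) (p : Fin r → ℝ) : Prop where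
  measurable : ∀ z, Measurable (π z)
  nonneg : ∀ z, ∀ᵐ x ∂μ, 0 ≤ π z x
  sum_eq_one : ∀ᵐ x ∂μ, ∑ z, π z x = 1
  ref_nonneg : ∀ z, 0 ≤ p z
  ref_sum : ∑ z, p z = 1
  abs_cont : ∀ z, p z = 0 → ∀ᵐ x ∂μ, π z x = 0

namespace Outcomes

variable {r : ℕ} {π : Fin r → X → ℝ} {p : Fin r → ℝ} {W : X → ℝ}

theorem le_one (h : Outcomes μ π p) (z : Fin r) : ∀ᵐ x ∂μ, π z x ≤ 1 := by
  filter_upwards [ae_all_iff.2 h.nonneg, h.sum_eq_one] with x h0 h1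
  rw [← h1]
  exact Finset.single_le_sum (f := fun z => π z x) (fun i _ => h0 i) (Finset.mem_univ z)

theorem isWeight_mul (h : Outcomes μ π p) (hW : IsWeight μ W) (z : Fin r) :
    IsWeight μ fun x => W x * π z x :=
  hW.mul (h.measurable z) (h.nonneg z) (h.le_one z)

theorem sum_integral [IsFiniteMeasure μ] (h : Outcomes μ π p) (hW : IsWeight μ W) :
    ∑ z, ∫ x, W x * π z x ∂μ = ∫ x, W x ∂μ := by
  rw [← integral_finsetSum _ fun z _ => (h.isWeight_mul hW z).integrable]
  refine integral_congr_ae ?_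
  filter_upwards [h.sum_eq_one] with x hx
  rw [← Finset.mul_sum, hx, mul_one]

theorem integral_eq_zero (h : Outcomes μ π p) {z : Fin r} (hz : p z = 0) :
    ∫ x, W x * π z x ∂μ = 0 := by
  rw [integral_congr_ae (g := fun _ => (0 : ℝ))]
  · simp
  · filter_upwards [h.abs_cont z hz] with x hx; simp [hx]

/-- The inequality `log t ≤ t - 1` at `t = a / b`. Summed over outcomes it bounds relative entropy
by chi-square; the term `a - b` cancels for laws of equal mass. -/
theorem mul_log_le {a b : ℝ} (ha : 0 ≤ a) (hb : 0 < b) :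
    a * Real.log a ≤ a * Real.log b + (a - b) ^ 2 / b + (a - b) := by
  rcases ha.eq_or_lt with rfl | ha
  · simp; field_simp; simp
  have h1 := Real.log_le_sub_one_of_pos (div_pos ha hb)
  rw [Real.log_div ha.ne' hb.ne'] at h1
  have h2 := mul_le_mul_of_nonneg_left h1 ha.le
  have h3 : a * (a / b - 1) = (a - b) ^ 2 / b + (a - b) := by field_simp; ring
  linarith

/-- The same inequality at `t = b / a`; summed, it is the nonnegativity of relative entropy. -/
theorem le_mul_log {a b : ℝ} (ha : 0 ≤ a) (hb : 0 < b) :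
    a * Real.log b + (a - b) ≤ a * Real.log a := by
  rcases ha.eq_or_lt with rfl | ha
  · simp; exact hb.le
  have h1 := Real.log_le_sub_one_of_pos (div_pos hb ha)
  rw [Real.log_div hb.ne' ha.ne'] at h1
  have h2 := mul_le_mul_of_nonneg_left h1 ha.le
  have h3 : a * (b / a - 1) = b - a := by field_simp
  linarith

/-- Chain rule for the relative entropy of the transcript: the new outcome contributes the relative
entropy of its posterior-mean law, which is at most the chi-square deviation. The mass `q` is the
reference probability of the node; `hq0` is absolute continuity, without which the convention `log
(x / 0) = 0` would spoil the bound. -/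
theorem sum_mul_log_le [IsProbabilityMeasure μ] (h : Outcomes μ π p) (hW : IsWeight μ W) {α q : ℝ}
    (hα : 0 ≤ α) (hq : 0 ≤ q) (hq0 : q = 0 → ∫ x, W x ∂μ = 0)
    (hS : ∑ z, (∫ x, W x * π z x ∂μ - (∫ x, W x ∂μ) * p z) ^ 2 / p z
      ≤ α * (∫ x, W x ∂μ) * entropy μ W) :
    ∑ z, (∫ x, W x * π z x ∂μ) * Real.log ((∫ x, W x * π z x ∂μ) / (q * p z))
      ≤ (∫ x, W x ∂μ) * Real.log ((∫ x, W x ∂μ) / q) + α * entropy μ W := by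
  set P := ∫ x, W x ∂μ with hP
  have hsum := h.sum_integral hW
  have hnn : ∀ z, 0 ≤ ∫ x, W x * π z x ∂μ := fun z => (h.isWeight_mul hW z).integral_nonneg
  rw [← hP] at hsum
  rcases hW.integral_nonneg.eq_or_lt with h0 | hpos
  · have : ∀ z, ∫ x, W x * π z x ∂μ = 0 := by
      intro z
      refine le_antisymm ?_ (hnn z)
      rw [← hP] at h0
      rw [h0, ← hsum]
      exact Finset.single_le_sum (f := fun z => ∫ x, W x * π z x ∂μ) (fun i _ => hnn i)
        (Finset.mem_univ z)
    simp only [this, zero_mul, Finset.sum_const_zero]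
    rw [hP, ← h0, zero_mul, zero_add]
    exact mul_nonneg hα hW.entropy_nonneg
  rw [← hP] at hpos
  have hqpos : 0 < q := hq.lt_of_ne fun e => hpos.ne' (hq0 e.symm)
  have key : ∀ z, (∫ x, W x * π z x ∂μ) * Real.log ((∫ x, W x * π z x ∂μ) / (q * p z))
      ≤ (∫ x, W x * π z x ∂μ) * Real.log (P / q)
        + P⁻¹ * ((∫ x, W x * π z x ∂μ - P * p z) ^ 2 / p z)
        + (∫ x, W x * π z x ∂μ - P * p z) := by
    intro z
    rcases (h.ref_nonneg z).eq_or_lt with hz | hz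
    · rw [h.integral_eq_zero hz.symm, ← hz]; simp
    · rcases (hnn z).eq_or_lt with ha | ha
      · rw [← ha]; simp; field_simp; simp
      have := mul_log_le ha.le (mul_pos hpos hz)
      rw [Real.log_div ha.ne' (by positivity), Real.log_div hpos.ne' hqpos.ne']
      rw [Real.log_mul hqpos.ne' hz.ne']
      rw [Real.log_mul hpos.ne' hz.ne'] at this
      have e : (∫ x, W x * π z x ∂μ - P * p z) ^ 2 / (P * p z)
        = P⁻¹ * ((∫ x, W x * π z x ∂μ - P * p z) ^ 2 / p z) := by field_simp
      rw [e] at this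
      linarith
  refine (Finset.sum_le_sum fun z _ => key z).trans ?_
  rw [Finset.sum_add_distrib, Finset.sum_add_distrib, ← Finset.sum_mul, hsum, ← Finset.mul_sum,
    Finset.sum_sub_distrib, hsum, ← Finset.mul_sum, h.ref_sum]
  have : P⁻¹ * ∑ z, (∫ x, W x * π z x ∂μ - P * p z) ^ 2 / p z ≤ α * entropy μ W := by
    calc _ ≤ P⁻¹ * (α * P * entropy μ W) := by gcongr
      _ = α * entropy μ W := by field_simp
  linarith

theorem abs_sum_div_le (h : Outcomes μ π p) :
    ∀ᵐ x ∂μ, |∑ z, (π z x - p z) ^ 2 / p z| ≤ ∑ z, 1 / p z := by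
  filter_upwards [ae_all_iff.2 h.nonneg, ae_all_iff.2 h.le_one] with x h0 h1
  rw [abs_of_nonneg (Finset.sum_nonneg fun z _ => div_nonneg (sq_nonneg _) (h.ref_nonneg z))]
  refine Finset.sum_le_sum fun z _ => div_le_div_of_nonneg_right ?_ (h.ref_nonneg z)
  have hp1 : p z ≤ 1 := by
    rw [← h.ref_sum]
    exact Finset.single_le_sum (fun i _ => h.ref_nonneg i) (Finset.mem_univ z)
  have := h.ref_nonneg z
  have := h0 z
  have := h1 z
  nlinarith

/-- The total entropy after the outcome equals the old one plus the posterior mean of the relative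
entropy of the outcome law to `p`, minus the relative entropy of the mean law. The former is at most
the chi-square mean, the latter is dropped by its sign. -/
theorem sum_entropy_le [IsProbabilityMeasure μ] (h : Outcomes μ π p) (hW : IsWeight μ W) :
    ∑ z, entropy μ (fun x => W x * π z x)
      ≤ entropy μ W + ∫ x, W x * ∑ z, (π z x - p z) ^ 2 / p z ∂μ := by
  set P := ∫ x, W x ∂μ with hP
  have hsum := h.sum_integral hW
  have hnn : ∀ z, 0 ≤ ∫ x, W x * π z x ∂μ := fun z => (h.isWeight_mul hW z).integral_nonneg
  rw [← hP] at hsum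
  have hmeas : Measurable fun x => ∑ z, (π z x - p z) ^ 2 / p z :=
    Finset.measurable_sum _ fun z _ => (((h.measurable z).sub_const _).pow_const 2).div_const _
  have iS := hW.integrable_mul hmeas h.abs_sum_div_le
  have iL : ∀ z, Integrable (fun x => W x * π z x * Real.log (p z)) μ := fun z =>
    (h.isWeight_mul hW z).integrable.mul_const _
  have i1 : ∑ z, ∫ x, W x * π z x * Real.log (W x * π z x) ∂μ
      ≤ ∫ x, W x * Real.log (W x) ∂μ + ∑ z, (∫ x, W x * π z x ∂μ) * Real.log (p z)
        + ∫ x, W x * ∑ z, (π z x - p z) ^ 2 / p z ∂μ := by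
    have : ∀ z, (∫ x, W x * π z x ∂μ) * Real.log (p z) = ∫ x, W x * π z x * Real.log (p z) ∂μ :=
      fun z => (integral_mul_const _ _).symm
    simp_rw [this]
    rw [← integral_finsetSum _ fun z _ => (h.isWeight_mul hW z).integrable_mul_log,
      ← integral_finsetSum _ fun z _ => iL z, ← integral_add' hW.integrable_mul_log
        (integrable_finsetSum _ fun z _ => iL z),
      ← integral_add' (hW.integrable_mul_log.add (integrable_finsetSum _ fun z _ => iL z)) iS]
    refine integral_mono_ae
      (integrable_finsetSum _ fun z _ => (h.isWeight_mul hW z).integrable_mul_log)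
      ((hW.integrable_mul_log.add (integrable_finsetSum _ fun z _ => iL z)).add iS) ?_
    filter_upwards [hW.nonneg, ae_all_iff.2 h.nonneg, h.sum_eq_one,
      ae_all_iff.2 fun z => Filter.eventually_imp_distrib_left.2 (h.abs_cont z)] with x hw h0 h1 hz
    have e : ∀ z, W x * π z x * Real.log (W x * π z x)
        ≤ π z x * (W x * Real.log (W x)) + (W x * π z x * Real.log (p z)
          + W x * ((π z x - p z) ^ 2 / p z) + W x * (π z x - p z)) := by
      intro z
      have e1 := Real.negMulLog_mul (W x) (π z x)
      simp only [Real.negMulLog] at e1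
      have e2 : W x * (π z x * Real.log (π z x)) ≤ W x * (π z x * Real.log (p z)
          + (π z x - p z) ^ 2 / p z + (π z x - p z)) := by
        refine mul_le_mul_of_nonneg_left ?_ hw
        rcases (h.ref_nonneg z).eq_or_lt with hp | hp
        · rw [hz z hp.symm, ← hp]; simp
        · exact mul_log_le (h0 z) hp
      linarith
    refine (Finset.sum_le_sum fun z _ => e z).trans (le_of_eq ?_)
    rw [Finset.sum_add_distrib, Finset.sum_add_distrib, Finset.sum_add_distrib, ← Finset.sum_mul,
      h1, ← Finset.mul_sum Finset.univ (fun z => π z x - p z), Finset.sum_sub_distrib, h1,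
      h.ref_sum, ← Finset.mul_sum Finset.univ (fun z => (π z x - p z) ^ 2 / p z)]
    simp only [Pi.add_apply]
    ring
  -- Nonnegativity of the relative entropy of the posterior-mean outcome law to `p`.
  have i2 : P * Real.log P + ∑ z, (∫ x, W x * π z x ∂μ) * Real.log (p z)
      ≤ ∑ z, (∫ x, W x * π z x ∂μ) * Real.log (∫ x, W x * π z x ∂μ) := by
    rcases hW.integral_nonneg.eq_or_lt with h0 | hpos
    · have : ∀ z, ∫ x, W x * π z x ∂μ = 0 := by
        intro z
        refine le_antisymm ?_ (hnn z)
        rw [h0, ← hP, ← hsum]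
        exact Finset.single_le_sum (f := fun z => ∫ x, W x * π z x ∂μ) (fun i _ => hnn i)
          (Finset.mem_univ z)
      simp [this, hP, ← h0]
    have e : ∀ z, (∫ x, W x * π z x ∂μ) * Real.log P + (∫ x, W x * π z x ∂μ) * Real.log (p z)
        + (∫ x, W x * π z x ∂μ - P * p z)
        ≤ (∫ x, W x * π z x ∂μ) * Real.log (∫ x, W x * π z x ∂μ) := by
      intro z
      rcases (h.ref_nonneg z).eq_or_lt with hp | hp
      · rw [h.integral_eq_zero hp.symm, ← hp]; simp
      · have := le_mul_log (hnn z) (mul_pos hpos hp)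
        rw [Real.log_mul hpos.ne' hp.ne'] at this
        linarith
    have := Finset.sum_le_sum fun z (_ : z ∈ Finset.univ) => e z
    rw [Finset.sum_add_distrib, Finset.sum_add_distrib, ← Finset.sum_mul, hsum,
      Finset.sum_sub_distrib, hsum, ← Finset.mul_sum, h.ref_sum] at this
    linarith
  simp only [entropy, Finset.sum_sub_distrib]
  rw [← hP]
  linarith

end Outcomes

end Entropy

/-! ### Induction along the decision tree -/

section Tree

variable {X : Type*} [MeasurableSpace X] {μ : Measure X} {ι : Type} [Fintype ι] [DecidableEq ι]

/-- The probability `Tr (ρ E)` of the effect `E` in the state `ρ`. -/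
def outcomeProb (ρ E : Matrix ι ι ℂ) : ℝ := (Matrix.trace (ρ * E)).re

/-- Every measurement of the random state `ρ x` compares with the reference state `ρ₀` as follows:
the posterior mean of an outcome probability deviates by at most the entropy of the posterior, and
the chi-square divergence has posterior mean at most the entropy plus a constant. -/
structure StepBound (μ : Measure X) (ρ : X → Matrix ι ι ℂ) (ρ₀ : Matrix ι ι ℂ) (α β : ℝ) :
    Prop where
  outcomes : ∀ {r : ℕ} (M : POVM ι r),
    Outcomes μ (fun z x => outcomeProb (ρ x) (M.elem z)) fun z => outcomeProb ρ₀ (M.elem z)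
  mean_le : ∀ {r : ℕ} (M : POVM ι r) {W : X → ℝ}, IsWeight μ W →
    ∑ z, (∫ x, W x * outcomeProb (ρ x) (M.elem z) ∂μ
      - (∫ x, W x ∂μ) * outcomeProb ρ₀ (M.elem z)) ^ 2 / outcomeProb ρ₀ (M.elem z)
      ≤ α * (∫ x, W x ∂μ) * entropy μ W
  chi_le : ∀ {r : ℕ} (M : POVM ι r) {W : X → ℝ}, IsWeight μ W →
    ∫ x, W x * ∑ z, (outcomeProb (ρ x) (M.elem z) - outcomeProb ρ₀ (M.elem z)) ^ 2
      / outcomeProb ρ₀ (M.elem z) ∂μ ≤ 2 * α * entropy μ W + β * ∫ x, W x ∂μ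

namespace IncoherentAlgorithm

theorem decisionProb_node {n r : ℕ} (M : POVM ι r) (next : Fin r → IncoherentAlgorithm ι n)
    (ρ : Matrix ι ι ℂ) (b : Bool) :
    (IncoherentAlgorithm.node M next).decisionProb ρ b
      = ∑ z, outcomeProb ρ (M.elem z) * (next z).decisionProb ρ b := rfl

theorem measurable_decisionProb {ρ : X → Matrix ι ι ℂ}
    (hρ : ∀ E : Matrix ι ι ℂ, Measurable fun x => outcomeProb (ρ x) E) (b : Bool) {n : ℕ}
    (alg : IncoherentAlgorithm ι n) : Measurable fun x => alg.decisionProb (ρ x) b := by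
  induction alg with
  | leaf d => exact measurable_const
  | node M next ih =>
    simp only [decisionProb_node]
    exact Finset.measurable_sum _ fun z _ => (hρ _).mul (ih z)

theorem decisionProb_mem {ρ : Matrix ι ι ℂ}
    (h0 : ∀ {r : ℕ} (M : POVM ι r) z, 0 ≤ outcomeProb ρ (M.elem z))
    (h1 : ∀ {r : ℕ} (M : POVM ι r), ∑ z, outcomeProb ρ (M.elem z) = 1) (b : Bool) {n : ℕ}
    (alg : IncoherentAlgorithm ι n) : alg.decisionProb ρ b ∈ Set.Icc (0 : ℝ) 1 := by
  induction alg with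
  | leaf d => simp only [decisionProb]; split_ifs <;> simp
  | node M next ih =>
    rw [decisionProb_node]
    refine ⟨Finset.sum_nonneg fun z _ => mul_nonneg (h0 M z) (ih z).1, ?_⟩
    rw [← h1 M]
    exact Finset.sum_le_sum fun z _ => mul_le_of_le_one_right (h0 M z) (ih z).2

theorem decisionProb_mem_ae {ρ : X → Matrix ι ι ℂ} {ρ₀ : Matrix ι ι ℂ}
    (h : ∀ {r : ℕ} (M : POVM ι r),
      Outcomes μ (fun z x => outcomeProb (ρ x) (M.elem z)) fun z => outcomeProb ρ₀ (M.elem z))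
    (b : Bool) {n : ℕ} (alg : IncoherentAlgorithm ι n) :
    ∀ᵐ x ∂μ, alg.decisionProb (ρ x) b ∈ Set.Icc (0 : ℝ) 1 := by
  induction alg with
  | leaf d =>
    refine Filter.Eventually.of_forall fun x => ?_
    simp only [decisionProb]
    split_ifs <;> simp
  | node M next ih =>
    filter_upwards [ae_all_iff.2 ih, ae_all_iff.2 (h M).nonneg, (h M).sum_eq_one] with x hx h0 h1
    rw [decisionProb_node]
    refine ⟨Finset.sum_nonneg fun z _ => mul_nonneg (h0 z) (hx z).1, ?_⟩
    rw [← h1]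
    exact Finset.sum_le_sum fun z _ => mul_le_of_le_one_right (h0 z) (hx z).2

theorem decisionProb_add {ρ : Matrix ι ι ℂ}
    (h1 : ∀ {r : ℕ} (M : POVM ι r), ∑ z, outcomeProb ρ (M.elem z) = 1) {n : ℕ}
    (alg : IncoherentAlgorithm ι n) :
    alg.decisionProb ρ true + alg.decisionProb ρ false = 1 := by
  induction alg with
  | leaf d => cases d <;> simp [decisionProb]
  | node M next ih =>
    simp only [decisionProb_node]
    rw [← Finset.sum_add_distrib, ← h1 M]
    exact Finset.sum_congr rfl fun z _ => by rw [← mul_add, ih, mul_one]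

end IncoherentAlgorithm

namespace StepBound

variable {ρ : X → Matrix ι ι ℂ} {ρ₀ : Matrix ι ι ℂ} {α β : ℝ}

/-- Relative entropy is carried in its dual form: the first line on the right is the unnormalised
divergence of the node masses `∫ W` and `q`, and together with `(exp s - 1) q f₀` it is the Legendre
bound for the test `s • decision`. This form is additive over children, so the whole transcript law
never has to be constructed. The last two terms pay for the entropy spent in the remaining `n`
steps. -/
theorem decisionProb_le_aux [IsProbabilityMeasure μ] (h : StepBound μ ρ ρ₀ α β) (hα : 0 ≤ α)
    (hβ : 0 ≤ β) (hρ : ∀ E : Matrix ι ι ℂ, Measurable fun x => outcomeProb (ρ x) E) (b : Bool)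
    (s : ℝ) {n : ℕ} (alg : IncoherentAlgorithm ι n) (hn : 3 * n * α ≤ 1) (W : X → ℝ)
    (hW : IsWeight μ W) (q : ℝ) (hq : 0 ≤ q) (hq0 : q = 0 → ∫ x, W x ∂μ = 0) :
    s * ∫ x, W x * alg.decisionProb (ρ x) b ∂μ
      ≤ (∫ x, W x ∂μ) * Real.log ((∫ x, W x ∂μ) / q) - ∫ x, W x ∂μ + q
        + (Real.exp s - 1) * (q * alg.decisionProb ρ₀ b)
        + 3 * n * α * entropy μ W + 3 * α * β * n ^ 2 * ∫ x, W x ∂μ := by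
  induction alg generalizing W q with
  | leaf d =>
    simp only [IncoherentAlgorithm.decisionProb, integral_mul_const]
    set p := ∫ x, W x ∂μ
    have hp : 0 ≤ p := hW.integral_nonneg
    suffices ∀ δ : ℝ, δ = 0 ∨ δ = 1 →
        s * (p * δ) ≤ p * Real.log (p / q) - p + q + (Real.exp s - 1) * (q * δ) by
      have := this (if d = b then 1 else 0) (by split_ifs <;> simp)
      simpa using this
    intro δ hδ
    have e : q + (Real.exp s - 1) * (q * δ) = q * Real.exp (s * δ) := by
      rcases hδ with rfl | rfl
      · simp
      · rw [mul_one, mul_one]; ring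
    suffices p * (s * δ) ≤ p * Real.log (p / q) - p + q * Real.exp (s * δ) by
      rw [← e] at this; linarith
    rcases hp.eq_or_lt with h0 | hpos
    · rw [← h0]; simp; positivity
    have hqpos : 0 < q := hq.lt_of_ne fun e => hpos.ne' (hq0 e.symm)
    -- At a leaf only Young's inequality between `log` and `exp` remains.
    have h1 := Real.add_one_le_exp (s * δ - Real.log (p / q))
    rw [Real.exp_sub, Real.exp_log (by positivity)] at h1
    have h2 := mul_le_mul_of_nonneg_left h1 hpos.le
    have h3 : p * (Real.exp (s * δ) / (p / q)) = q * Real.exp (s * δ) := by field_simp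
    linarith
  | @node n r M next ih =>
    have hO := h.outcomes M
    have hn' : 3 * (n : ℝ) * α ≤ 1 := by push_cast at hn; linarith
    set P := ∫ x, W x ∂μ with hP
    have hPnn : 0 ≤ P := hW.integral_nonneg
    have hE := hW.entropy_nonneg
    have IH := fun z => ih z hn' _ (hO.isWeight_mul hW z) (q * outcomeProb ρ₀ (M.elem z))
      (mul_nonneg hq (hO.ref_nonneg z)) (fun e => by
        rcases mul_eq_zero.1 e with e | e
        · have hz := hW.ae_eq_zero (hq0 e)
          rw [integral_congr_ae (g := fun _ => (0 : ℝ))]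
          · simp
          · filter_upwards [hz] with x hx; simp [hx]
        · exact hO.integral_eq_zero e)
    have hsum := Finset.sum_le_sum fun z (_ : z ∈ Finset.univ) => IH z
    rw [← Finset.mul_sum] at hsum
    simp only [Finset.sum_add_distrib, Finset.sum_sub_distrib, ← Finset.mul_sum] at hsum
    rw [hO.sum_integral hW, hO.ref_sum, ← hP] at hsum
    have hl : ∑ z, ∫ x, W x * outcomeProb (ρ x) (M.elem z) * (next z).decisionProb (ρ x) b ∂μ
        = ∫ x, W x * (IncoherentAlgorithm.node M next).decisionProb (ρ x) b ∂μ := by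
      rw [← integral_finsetSum]
      · refine integral_congr_ae (Filter.Eventually.of_forall fun x => ?_)
        simp only [IncoherentAlgorithm.decisionProb_node, Finset.mul_sum, mul_assoc]
      · intro z _
        refine (hO.isWeight_mul hW z).integrable_mul
          (IncoherentAlgorithm.measurable_decisionProb hρ b (next z)) (K := 1) ?_
        have hall : ∀ᵐ x ∂μ, (next z).decisionProb (ρ x) b ∈ Set.Icc (0 : ℝ) 1 :=
          IncoherentAlgorithm.decisionProb_mem_ae h.outcomes b (next z)
        filter_upwards [hall] with x hx
        exact abs_le.2 ⟨by linarith [hx.1], hx.2⟩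
    rw [hl] at hsum
    have hr : ∑ z, q * outcomeProb ρ₀ (M.elem z) * (next z).decisionProb ρ₀ b
        = q * (IncoherentAlgorithm.node M next).decisionProb ρ₀ b := by
      simp only [IncoherentAlgorithm.decisionProb_node, Finset.mul_sum, mul_assoc]
    rw [hr, mul_one] at hsum
    have s1 := hO.sum_mul_log_le hW hα hq hq0 (h.mean_le M hW)
    have s2 := hO.sum_entropy_le hW
    have s3 := h.chi_le M hW
    rw [← hP] at s1 s3
    have hnα : 0 ≤ 3 * (n : ℝ) * α := by positivity
    have s4 : 3 * n * α * ∑ z, entropy μ (fun x => W x * outcomeProb (ρ x) (M.elem z))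
        ≤ 3 * n * α * (entropy μ W + (2 * α * entropy μ W + β * P)) :=
      mul_le_mul_of_nonneg_left (s2.trans (by linarith)) hnα
    -- Entropy budget: `α` for the divergence, `3nα` for the children, and at most `2α` for the
    -- growth factor `1 + 2α`, in total `3(n+1)α`. The constant `β` adds `3nαβ`, which fits into the
    -- increase from `n²` to `(n+1)²`.
    have s5 : 3 * n * α * (2 * α * entropy μ W) ≤ 2 * α * entropy μ W :=
      mul_le_of_le_one_left (by positivity) hn'
    have s6 : 0 ≤ 3 * α * β * ((n : ℝ) + 1) * P := by positivity
    push_cast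
    nlinarith

/-- Few measurements cannot tell the random state from the reference state. -/
theorem integral_decisionProb_le [IsProbabilityMeasure μ] (h : StepBound μ ρ ρ₀ α β) (hα : 0 ≤ α)
    (hβ : 0 ≤ β) (hρ : ∀ E : Matrix ι ι ℂ, Measurable fun x => outcomeProb (ρ x) E) (b : Bool)
    {s : ℝ} (hs : 0 < s) (hs1 : s ≤ 1) {n : ℕ} (alg : IncoherentAlgorithm ι n)
    (hn : 3 * n * α ≤ 1) (hB : 3 * α * β * n ^ 2 ≤ s ^ 2)
    (h₀ : alg.decisionProb ρ₀ b ∈ Set.Icc (0 : ℝ) 1) :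
    ∫ x, alg.decisionProb (ρ x) b ∂μ ≤ alg.decisionProb ρ₀ b + 2 * s := by
  have hW : IsWeight μ fun _ : X => (1 : ℝ) :=
    ⟨measurable_const, by simp, by simp⟩
  -- At the root the posterior is the prior, so entropy and divergence both vanish.
  have := h.decisionProb_le_aux hα hβ hρ b s alg hn _ hW 1 zero_le_one (by simp)
  simp only [entropy, one_mul, integral_const, probReal_univ, smul_eq_mul, mul_one, Real.log_one,
    mul_zero, sub_self, div_one, zero_add, add_zero, neg_add_cancel, zero_sub] at this
  have he : Real.exp s - 1 ≤ s + s ^ 2 := by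
    have := Real.abs_exp_sub_one_sub_id_le (x := s) (by rwa [abs_of_pos hs])
    linarith [le_abs_self (Real.exp s - 1 - s)]
  have h2 : (Real.exp s - 1) * alg.decisionProb ρ₀ b ≤ s * alg.decisionProb ρ₀ b + s ^ 2 := by
    have := h₀.1
    have := h₀.2
    nlinarith [mul_le_mul_of_nonneg_right he h₀.1, sq_nonneg s]
  have h3 : s * ∫ x, alg.decisionProb (ρ x) b ∂μ ≤ s * (alg.decisionProb ρ₀ b + 2 * s) := by
    nlinarith
  exact le_of_mul_le_mul_left h3 hs

end StepBound

end Tree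

/-! ### Gaussian exponential moments -/

section Gaussian

theorem lintegral_exp_mul_gaussianReal (v : ℝ≥0) (t : ℝ) :
    ∫⁻ x, ENNReal.ofReal (Real.exp (t * x)) ∂(gaussianReal 0 v)
      = ENNReal.ofReal (Real.exp (v * t ^ 2 / 2)) := by
  rw [← ofReal_integral_eq_lintegral_ofReal (integrable_exp_mul_gaussianReal t)
    (Filter.Eventually.of_forall fun x => (Real.exp_pos _).le)]
  have := mgf_gaussianReal (p := gaussianReal 0 v) (X := id) (μ := 0) (v := v) (by simp) t
  simp only [mgf, id, zero_mul, zero_add] at this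
  rw [this]

theorem lintegral_exp_mul_sq_gaussianReal {v : ℝ≥0} (hv : v ≠ 0) {a : ℝ} (ha : 2 * a * v < 1) :
    ∫⁻ x, ENNReal.ofReal (Real.exp (a * x ^ 2)) ∂(gaussianReal 0 v)
      = ENNReal.ofReal (√(1 / (1 - 2 * a * v))) := by
  have hv' : (0 : ℝ) < v := by positivity
  have hb : 0 < 1 / (2 * v) - a := by
    rw [sub_pos, lt_div_iff₀ (by positivity)]; linarith
  rw [gaussianReal_of_var_ne_zero _ hv,
    lintegral_withDensity_eq_lintegral_mul _ (measurable_gaussianPDF 0 v) (by fun_prop)]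
  have e : ∀ x : ℝ, (gaussianPDF 0 v * fun x => ENNReal.ofReal (Real.exp (a * x ^ 2))) x
      = ENNReal.ofReal ((√(2 * Real.pi * v))⁻¹ * Real.exp (-(1 / (2 * v) - a) * x ^ 2)) := by
    intro x
    rw [Pi.mul_apply, gaussianPDF, ← ENNReal.ofReal_mul (gaussianPDFReal_nonneg _ _ _),
      gaussianPDFReal, mul_assoc, ← Real.exp_add]
    congr 3
    field_simp
    ring
  simp_rw [e]
  rw [← ofReal_integral_eq_lintegral_ofReal ((integrable_exp_neg_mul_sq hb).const_mul _)
    (Filter.Eventually.of_forall fun x => by positivity), integral_const_mul, integral_gaussian,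
    ← Real.sqrt_inv, ← Real.sqrt_mul (by positivity)]
  congr 2
  have h1 : 1 - 2 * a * v ≠ 0 := by linarith
  have h2 : 1 / (2 * (v : ℝ)) - a = (1 - 2 * a * v) / (2 * v) := by field_simp
  rw [h2]
  field_simp

/-- The moment is `(1 - γ/2)^(-1/2)`, and `exp γ (1 - γ/2) ≥ 1` on `[0, 1]` follows from the
quadratic lower bound on `exp`. -/
theorem lintegral_exp_quarter_sq_le {γ : ℝ} (h0 : 0 ≤ γ) (h1 : γ ≤ 1) :
    ∫⁻ x, ENNReal.ofReal (Real.exp (γ / 4 * x ^ 2)) ∂(gaussianReal 0 1)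
      ≤ ENNReal.ofReal (Real.exp (γ / 2)) := by
  rw [lintegral_exp_mul_sq_gaussianReal one_ne_zero (by simp; linarith)]
  refine ENNReal.ofReal_le_ofReal (Real.sqrt_le_iff.2 ⟨(Real.exp_pos _).le, ?_⟩)
  rw [← Real.exp_nat_mul, div_le_iff₀ (by simp; linarith)]
  have h2 : Real.exp (((2 : ℕ) : ℝ) * (γ / 2)) = Real.exp γ := by congr 1; push_cast; ring
  rw [h2]
  have h3 := Real.quadratic_le_exp_of_nonneg h0
  simp only [NNReal.coe_one]
  nlinarith [mul_nonneg h0 h0, mul_nonneg (mul_nonneg h0 h0) (sub_nonneg.2 h1)]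

theorem lintegral_pi_prod_eq {ι : Type*} [Fintype ι] {E : Type*} [MeasurableSpace E]
    {μ : ι → Measure E} [∀ i, IsProbabilityMeasure (μ i)] {f : ι → E → ℝ≥0∞}
    (hf : ∀ i, Measurable (f i)) :
    ∫⁻ x, ∏ i, f i (x i) ∂(Measure.pi μ) = ∏ i, ∫⁻ x, f i x ∂(μ i) := by
  have h := lintegral_prod_eq_prod_lintegral_of_indepFun Finset.univ
    (fun i (x : ι → E) => f i (x i))
    (iIndepFun_pi (μ := μ) (X := fun i => f i) fun i => (hf i).aemeasurable)
    fun i => (hf i).comp (measurable_pi_apply i)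
  rw [h]
  exact Finset.prod_congr rfl fun i _ =>
    (measurePreserving_eval μ i).lintegral_comp (hf i)

end Gaussian

/-! ### Sub-Gaussian vectors: quadratic and linear functionals under a posterior -/

section SubGaussian

variable {X : Type*} [MeasurableSpace X] {μ : Measure X} {V : Type*} [NormedAddCommGroup V]
  [InnerProductSpace ℝ V]

/-- The random vector `Y` has measurable coordinates and `E exp ⟨S, Y⟩ ≤ exp (c ‖S‖²)`. -/
structure IsSubGaussian (μ : Measure X) (Y : X → V) (c : ℝ) : Prop where
  measurable : ∀ S, Measurable fun x => inner ℝ S (Y x)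
  lintegral_le : ∀ S, ∫⁻ x, ENNReal.ofReal (Real.exp (inner ℝ S (Y x))) ∂μ
    ≤ ENNReal.ofReal (Real.exp (c * ‖S‖ ^ 2))

/-- The eigenvectors of the Gram matrix of `b` give an orthogonal system with the same sum of
squares. -/
theorem exists_orthogonal_system {r : ℕ} (b : Fin r → V)
    (hb : ∀ v : Fin r → ℝ, ‖∑ z, v z • b z‖ ^ 2 ≤ ∑ z, v z ^ 2) :
    ∃ (e : Fin r → V) (γ : Fin r → ℝ), (∀ i, 0 ≤ γ i) ∧ (∀ i, γ i ≤ 1) ∧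
      ∑ i, γ i = ∑ z, ‖b z‖ ^ 2 ∧
      (∀ y, ∑ i, inner ℝ (e i) y ^ 2 = ∑ z, inner ℝ (b z) y ^ 2) ∧
      ∀ g : Fin r → ℝ, ‖∑ i, g i • e i‖ ^ 2 = ∑ i, γ i * g i ^ 2 := by
  have hG := Matrix.isHermitian_gram ℝ b
  set v := hG.eigenvectorBasis with hv
  set e : Fin r → V := fun i => ∑ z, v i z • b z with he
  have hbe : ∀ z j, inner ℝ (b z) (e j) = hG.eigenvalues j * v j z := by
    intro z j
    have := congrFun (hG.mulVec_eigenvectorBasis j) z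
    simp only [Matrix.mulVec, dotProduct, Matrix.gram_apply, Pi.smul_apply, smul_eq_mul] at this
    rw [← this, he, inner_sum]
    exact Finset.sum_congr rfl fun z' _ => by rw [inner_smul_right, mul_comm]
  have hvv : ∀ i j, ∑ z, v i z * v j z = if i = j then 1 else 0 := by
    intro i j
    have := orthonormal_iff_ite.1 v.orthonormal i j
    rw [← this, PiLp.inner_apply]
    exact Finset.sum_congr rfl fun z _ => by simp [mul_comm]
  have hee : ∀ i j, inner ℝ (e i) (e j) = if i = j then hG.eigenvalues i else 0 := by
    intro i j
    rw [show e i = ∑ z, v i z • b z from rfl, sum_inner]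
    simp_rw [inner_smul_left, hbe]
    have : ∑ z, (v i z) * (hG.eigenvalues j * v j z)
        = hG.eigenvalues j * ∑ z, v i z * v j z := by
      rw [Finset.mul_sum]; exact Finset.sum_congr rfl fun z _ => by ring
    simp only [conj_trivial]
    rw [this, hvv]
    split_ifs with h
    · rw [h, mul_one]
    · rw [mul_zero]
  have hn : ∀ i, hG.eigenvalues i = ‖e i‖ ^ 2 := fun i => by
    rw [← real_inner_self_eq_norm_sq, hee, if_pos rfl]
  refine ⟨e, hG.eigenvalues, fun i => ?_, fun i => ?_, ?_, fun y => ?_, fun g => ?_⟩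
  · rw [hn]; positivity
  · rw [hn]
    refine (hb _).trans (le_of_eq ?_)
    have := hvv i i
    rw [if_pos rfl] at this
    rw [← this]
    exact Finset.sum_congr rfl fun z _ => by ring
  · have := hG.trace_eq_sum_eigenvalues
    simp only [RCLike.ofReal_real_eq_id, id] at this
    rw [← this, Matrix.trace]
    exact Finset.sum_congr rfl fun z _ => by
      rw [Matrix.diag_apply, Matrix.gram_apply, real_inner_self_eq_norm_sq]
  · have h1 : ∀ i, inner ℝ (e i) y = inner ℝ (v i) (WithLp.toLp 2 fun z => inner ℝ (b z) y) := by
      intro i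
      rw [show e i = ∑ z, v i z • b z from rfl, sum_inner, PiLp.inner_apply]
      exact Finset.sum_congr rfl fun z _ => by simp [inner_smul_left, mul_comm]
    simp_rw [h1]
    have := v.sum_sq_norm_inner_right (WithLp.toLp 2 fun z => inner ℝ (b z) y)
    simp only [Real.norm_eq_abs, sq_abs] at this
    rw [this, EuclideanSpace.real_norm_sq_eq]
  · rw [← real_inner_self_eq_norm_sq, sum_inner]
    refine Finset.sum_congr rfl fun i _ => ?_
    rw [inner_sum]
    simp_rw [inner_smul_left, inner_smul_right, hee]
    simp; ring

/-- A Hanson-Wright bound for the exponential moment of a quadratic form. -/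
theorem IsSubGaussian.lintegral_exp_sum_sq_le [SFinite μ] {Y : X → V} {c : ℝ} (hc : 0 < c)
    (h : IsSubGaussian μ Y c) {r : ℕ} (b : Fin r → V)
    (hb : ∀ v : Fin r → ℝ, ‖∑ z, v z • b z‖ ^ 2 ≤ ∑ z, v z ^ 2) :
    ∫⁻ x, ENNReal.ofReal (Real.exp (1 / (8 * c) * ∑ z, inner ℝ (b z) (Y x) ^ 2)) ∂μ
      ≤ ENNReal.ofReal (Real.exp ((∑ z, ‖b z‖ ^ 2) / 2)) := by
  obtain ⟨e, γ, h0, h1, hγ, hsq, hnorm⟩ := exists_orthogonal_system b hb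
  -- Linearisation by an auxiliary Gaussian: `exp (t² u² / 2)` is the mean of `exp (t g u)`, and `t²
  -- / 2 = 1 / (8 c)`. After swapping the integrals the sub-Gaussian bound leaves `exp (γ_i g_i² /
  -- 4)`, a product because the vectors `e i` are orthogonal.
  set t := √(1 / (4 * c)) with ht
  have ht2 : t ^ 2 = 1 / (4 * c) := Real.sq_sqrt (by positivity)
  set G : Measure (Fin r → ℝ) := Measure.pi fun _ => gaussianReal 0 1 with hG
  have e1 : ∀ x, ENNReal.ofReal (Real.exp (1 / (8 * c) * ∑ z, inner ℝ (b z) (Y x) ^ 2))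
      = ∫⁻ g, ENNReal.ofReal (Real.exp (inner ℝ (∑ i, (t * g i) • e i) (Y x))) ∂G := by
    intro x
    have : ∀ g : Fin r → ℝ, ENNReal.ofReal (Real.exp (inner ℝ (∑ i, (t * g i) • e i) (Y x)))
        = ∏ i, ENNReal.ofReal (Real.exp (t * inner ℝ (e i) (Y x) * g i)) := by
      intro g
      rw [← ENNReal.ofReal_prod_of_nonneg fun i _ => (Real.exp_pos _).le, ← Real.exp_sum, sum_inner]
      congr 2
      exact Finset.sum_congr rfl fun i _ => by rw [inner_smul_left]; simp; ring
    simp_rw [this]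
    rw [lintegral_pi_prod_eq (μ := fun _ => gaussianReal 0 1)
      (f := fun i y => ENNReal.ofReal (Real.exp (t * inner ℝ (e i) (Y x) * y)))
      fun i => by fun_prop]
    simp_rw [lintegral_exp_mul_gaussianReal]
    rw [← ENNReal.ofReal_prod_of_nonneg fun i _ => (Real.exp_pos _).le, ← Real.exp_sum, ← hsq,
      Finset.mul_sum]
    congr 2
    refine Finset.sum_congr rfl fun i _ => ?_
    rw [mul_pow, ht2, NNReal.coe_one]
    field_simp; ring
  simp_rw [e1]
  have hmeas : Measurable (Function.uncurry fun (x : X) (g : Fin r → ℝ) =>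
      ENNReal.ofReal (Real.exp (inner ℝ (∑ i, (t * g i) • e i) (Y x)))) := by
    have : ∀ p : X × (Fin r → ℝ), inner ℝ (∑ i, (t * p.2 i) • e i) (Y p.1)
        = ∑ i, t * p.2 i * inner ℝ (e i) (Y p.1) := by
      intro p; rw [sum_inner]
      exact Finset.sum_congr rfl fun i _ => by rw [inner_smul_left]; simp
    simp only [Function.uncurry_def, this]
    refine ENNReal.measurable_ofReal.comp (Real.measurable_exp.comp
      (Finset.measurable_sum _ fun i _ => Measurable.mul (by fun_prop)
        ((h.measurable (e i)).comp measurable_fst)))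
  rw [lintegral_lintegral_swap hmeas.aemeasurable]
  calc ∫⁻ g, ∫⁻ x, ENNReal.ofReal (Real.exp (inner ℝ (∑ i, (t * g i) • e i) (Y x))) ∂μ ∂G
      ≤ ∫⁻ g, ∏ i, ENNReal.ofReal (Real.exp (γ i / 4 * g i ^ 2)) ∂G := by
        refine lintegral_mono fun g => (h.lintegral_le _).trans (le_of_eq ?_)
        rw [← ENNReal.ofReal_prod_of_nonneg fun i _ => (Real.exp_pos _).le, ← Real.exp_sum, hnorm,
          Finset.mul_sum]
        congr 2
        refine Finset.sum_congr rfl fun i _ => ?_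
        rw [mul_pow, ht2]
        field_simp
    _ = ∏ i, ∫⁻ x, ENNReal.ofReal (Real.exp (γ i / 4 * x ^ 2)) ∂(gaussianReal 0 1) :=
        lintegral_pi_prod_eq (μ := fun _ => gaussianReal 0 1)
          (f := fun i y => ENNReal.ofReal (Real.exp (γ i / 4 * y ^ 2))) fun i => by fun_prop
    _ ≤ ∏ i, ENNReal.ofReal (Real.exp (γ i / 2)) :=
        Finset.prod_le_prod' fun i _ => lintegral_exp_quarter_sq_le (h0 i) (h1 i)
    _ = ENNReal.ofReal (Real.exp ((∑ z, ‖b z‖ ^ 2) / 2)) := by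
        rw [← ENNReal.ofReal_prod_of_nonneg fun i _ => (Real.exp_pos _).le, ← Real.exp_sum, ← hγ,
          Finset.sum_div]

theorem integral_exp_le_of_lintegral {f : X → ℝ} (hf : Measurable f) {c : ℝ}
    (h : ∫⁻ x, ENNReal.ofReal (Real.exp (f x)) ∂μ ≤ ENNReal.ofReal (Real.exp c)) :
    ∫ x, Real.exp (f x) ∂μ ≤ Real.exp c := by
  rw [integral_eq_lintegral_of_nonneg_ae (Filter.Eventually.of_forall fun x => (Real.exp_pos _).le)
    (Real.measurable_exp.comp hf).aestronglyMeasurable]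
  exact ENNReal.toReal_le_of_le_ofReal (Real.exp_pos _).le h

/-- The posterior mean of a quadratic form is controlled by the entropy of the posterior. -/
theorem IsSubGaussian.integral_sum_sq_le [IsProbabilityMeasure μ] {Y : X → V} {c : ℝ} (hc : 0 < c)
    (h : IsSubGaussian μ Y c) {K : ℝ} (hK : ∀ᵐ x ∂μ, ‖Y x‖ ≤ K) {r : ℕ} (b : Fin r → V)
    (hb : ∀ v : Fin r → ℝ, ‖∑ z, v z • b z‖ ^ 2 ≤ ∑ z, v z ^ 2) {W : X → ℝ}
    (hW : IsWeight μ W) :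
    ∫ x, W x * ∑ z, inner ℝ (b z) (Y x) ^ 2 ∂μ
      ≤ 8 * c * entropy μ W + 4 * c * (∑ z, ‖b z‖ ^ 2) * ∫ x, W x ∂μ := by
  have hm : Measurable fun x => 1 / (8 * c) * ∑ z, inner ℝ (b z) (Y x) ^ 2 :=
    (Finset.measurable_sum _ fun z _ => (h.measurable (b z)).pow_const 2).const_mul _
  have hbd : ∀ᵐ x ∂μ, |1 / (8 * c) * ∑ z, inner ℝ (b z) (Y x) ^ 2|
      ≤ 1 / (8 * c) * ∑ z, (‖b z‖ * K) ^ 2 := by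
    filter_upwards [hK] with x hx
    rw [abs_of_nonneg (by positivity)]
    refine mul_le_mul_of_nonneg_left (Finset.sum_le_sum fun z _ => ?_) (by positivity)
    rw [← sq_abs]
    exact pow_le_pow_left₀ (abs_nonneg _)
      ((abs_real_inner_le_norm _ _).trans (by gcongr)) 2
  have := hW.integral_mul_le hm hbd
    (integral_exp_le_of_lintegral hm (h.lintegral_exp_sum_sq_le hc b hb))
  have e : ∀ x, W x * (1 / (8 * c) * ∑ z, inner ℝ (b z) (Y x) ^ 2)
      = 1 / (8 * c) * (W x * ∑ z, inner ℝ (b z) (Y x) ^ 2) := fun x => by ring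
  simp_rw [e] at this
  rw [integral_const_mul] at this
  have h2 := mul_le_mul_of_nonneg_left this (show 0 ≤ 8 * c by positivity)
  rw [← mul_assoc, mul_one_div_cancel (by positivity), one_mul] at h2
  linarith

/-- The posterior mean is controlled by the entropy of the posterior. -/
theorem IsSubGaussian.sum_sq_integral_le [IsProbabilityMeasure μ] {Y : X → V} {c : ℝ} (hc : 0 < c)
    (h : IsSubGaussian μ Y c) {K : ℝ} (hK : ∀ᵐ x ∂μ, ‖Y x‖ ≤ K) {r : ℕ} (b : Fin r → V)
    (hb : ∀ v : Fin r → ℝ, ‖∑ z, v z • b z‖ ^ 2 ≤ ∑ z, v z ^ 2) {W : X → ℝ}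
    (hW : IsWeight μ W) :
    ∑ z, (∫ x, W x * inner ℝ (b z) (Y x) ∂μ) ^ 2
      ≤ 4 * c * (∫ x, W x ∂μ) * entropy μ W := by
  set p := ∫ x, W x ∂μ with hp
  set w : Fin r → ℝ := fun z => ∫ x, W x * inner ℝ (b z) (Y x) ∂μ with hw
  have hint : ∀ S : V, Integrable (fun x => W x * inner ℝ S (Y x)) μ := fun S =>
    hW.integrable_mul (h.measurable S) (K := ‖S‖ * K) (by
      filter_upwards [hK] with x hx
      exact (abs_real_inner_le_norm _ _).trans (by gcongr))
  rcases hW.integral_nonneg.eq_or_lt with h0 | hpos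
  · have hz := hW.ae_eq_zero h0.symm
    have : ∀ z, w z = 0 := fun z => by
      rw [hw]; dsimp only
      rw [integral_congr_ae (g := fun _ => (0 : ℝ))]
      · simp
      · filter_upwards [hz] with x hx; simp [hx]
    rw [← hp] at h0
    rw [← h0, mul_zero, zero_mul]
    exact (Finset.sum_eq_zero fun z _ => by rw [pow_eq_zero_iff two_ne_zero]; exact this z).le
  rw [← hp] at hpos
  set A := ∑ z, w z ^ 2 with hA
  set t := 1 / (2 * c * p) with ht
  set S : V := t • ∑ z, w z • b z with hS
  have hm := h.measurable S
  have hDV := hW.integral_mul_le hm (K := ‖S‖ * K) (by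
      filter_upwards [hK] with x hx
      exact (abs_real_inner_le_norm _ _).trans (by gcongr))
    (integral_exp_le_of_lintegral hm (h.lintegral_le S))
  have e1 : ∫ x, W x * inner ℝ S (Y x) ∂μ = t * A := by
    have : ∀ x, W x * inner ℝ S (Y x) = t * ∑ z, w z * (W x * inner ℝ (b z) (Y x)) := by
      intro x
      rw [hS, inner_smul_left, sum_inner, Finset.mul_sum, Finset.mul_sum, Finset.mul_sum]
      refine Finset.sum_congr rfl fun z _ => ?_
      rw [inner_smul_left]; simp; ring
    simp_rw [this]
    rw [integral_const_mul, integral_finsetSum _ fun z _ => (hint (b z)).const_mul _, hA]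
    simp_rw [integral_const_mul]
    congr 1
    exact Finset.sum_congr rfl fun z _ => by rw [sq]
  have e2 : ‖S‖ ^ 2 ≤ t ^ 2 * A := by
    rw [hS, norm_smul, mul_pow, Real.norm_eq_abs, sq_abs]
    exact mul_le_mul_of_nonneg_left (hb w) (sq_nonneg t)
  rw [e1, ← hp] at hDV
  have h3 : t * A ≤ entropy μ W + p * (c * (t ^ 2 * A)) := hDV.trans (by gcongr)
  have h4 : p * (c * (t ^ 2 * A)) = t * A / 2 := by rw [ht]; field_simp
  have h5 : A / (4 * c * p) ≤ entropy μ W := by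
    have : t * A / 2 = A / (4 * c * p) := by rw [ht]; field_simp; ring
    linarith
  rw [div_le_iff₀ (by positivity)] at h5
  linarith

end SubGaussian

/-! ### The centered ensemble: sub-Gaussianity, symmetry and Frobenius norm -/

section GOE

instance instBorelSpaceMatrix {p q : Type*} [Countable p] [Countable q] :
    BorelSpace (Matrix p q ℝ) :=
  inferInstanceAs (BorelSpace (p → q → ℝ))

theorem measurable_matrix_entry {p q : Type*} (i : p) (j : q) :
    Measurable fun M : Matrix p q ℝ => M i j :=
  (measurable_pi_apply j).comp (measurable_pi_apply i)

theorem measurable_matrix_iff {X p q : Type*} [MeasurableSpace X] {f : X → Matrix p q ℝ}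
    (h : ∀ i j, Measurable fun x => f x i j) : Measurable f :=
  measurable_pi_iff.2 fun i => measurable_pi_iff.2 fun j => h i j

/-- A matrix as a vector of the Euclidean space of its entries, with the Frobenius norm. -/
def vec {d : ℕ} (M : Matrix (Fin d) (Fin d) ℝ) : EuclideanSpace ℝ (Fin d × Fin d) :=
  WithLp.toLp 2 fun p => M p.1 p.2

theorem inner_vec {d : ℕ} (S : EuclideanSpace ℝ (Fin d × Fin d)) (M : Matrix (Fin d) (Fin d) ℝ) :
    inner ℝ S (vec M) = ∑ i, ∑ j, S (i, j) * M i j := by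
  rw [PiLp.inner_apply, Fintype.sum_prod_type]
  exact Finset.sum_congr rfl fun i _ => Finset.sum_congr rfl fun j _ => by
    simp [vec, mul_comm]

theorem norm_vec_sq {d : ℕ} (M : Matrix (Fin d) (Fin d) ℝ) :
    ‖vec M‖ ^ 2 = ∑ i, ∑ j, M i j ^ 2 := by
  rw [EuclideanSpace.real_norm_sq_eq, Fintype.sum_prod_type]; rfl

/-- The array of independent Gaussian variables behind `goe d`. -/
def gaussianArray (d : ℕ) : Measure (Fin d → Fin d → ℝ) :=
  Measure.pi fun i : Fin d => Measure.pi fun j : Fin d =>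
    gaussianReal 0 (if i = j then 2 / (d : ℝ≥0) else 1 / (d : ℝ≥0))

/-- The traceless symmetric matrix built from the upper triangle of an array. -/
def centeredReflection (d : ℕ) (W : Fin d → Fin d → ℝ) : Matrix (Fin d) (Fin d) ℝ :=
  Matrix.of (fun i j => W (min i j) (max i j))
    - ((∑ i, W i i) / (d : ℝ)) • (1 : Matrix (Fin d) (Fin d) ℝ)

instance (d : ℕ) : IsProbabilityMeasure (gaussianArray d) := by
  unfold gaussianArray; infer_instance

theorem centeredReflection_apply (d : ℕ) (W : Fin d → Fin d → ℝ) (i j : Fin d) :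
    centeredReflection d W i j
      = W (min i j) (max i j) - (∑ i, W i i) / d * if i = j then 1 else 0 := by
  simp [centeredReflection, Matrix.one_apply]

theorem measurable_centeredReflection (d : ℕ) : Measurable (centeredReflection d) := by
  refine measurable_matrix_iff fun i j => ?_
  simp only [centeredReflection_apply]
  fun_prop

theorem goeStar_eq_map (d : ℕ) : goeStar d = (gaussianArray d).map (centeredReflection d) := by
  rw [goeStar, goe, Measure.map_map]
  · congr 1
    funext W
    simp [centeredReflection, Matrix.trace]
  · refine measurable_matrix_iff fun i j => ?_
    simp only [Matrix.sub_apply, Matrix.smul_apply, Matrix.trace, Matrix.diag_apply, smul_eq_mul]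
    fun_prop
  · refine measurable_matrix_iff fun i j => ?_
    simp only [Matrix.of_apply]
    fun_prop

instance (d : ℕ) : IsProbabilityMeasure (goeStar d) := by
  rw [goeStar_eq_map]
  exact Measure.isProbabilityMeasure_map (measurable_centeredReflection d).aemeasurable

theorem lintegral_goeStar (d : ℕ) {f : Matrix (Fin d) (Fin d) ℝ → ℝ≥0∞} (hf : Measurable f) :
    ∫⁻ M, f M ∂(goeStar d) = ∫⁻ W, f (centeredReflection d W) ∂(gaussianArray d) := by
  rw [goeStar_eq_map, lintegral_map hf (measurable_centeredReflection d)]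

theorem lintegral_gaussianArray_prod (d : ℕ) {f : Fin d → Fin d → ℝ → ℝ≥0∞}
    (hf : ∀ i j, Measurable (f i j)) :
    ∫⁻ W, ∏ i, ∏ j, f i j (W i j) ∂(gaussianArray d)
      = ∏ i, ∏ j, ∫⁻ x, f i j x
        ∂(gaussianReal 0 (if i = j then 2 / (d : ℝ≥0) else 1 / (d : ℝ≥0))) := by
  rw [gaussianArray, lintegral_pi_prod_eq (E := Fin d → ℝ)
    (f := fun i w => ∏ j, f i j (w j)) fun i => by fun_prop]
  exact Finset.prod_congr rfl fun i _ => lintegral_pi_prod_eq fun j => hf i j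

theorem goeStar_symm_traceless (d : ℕ) (hd : 0 < d) :
    ∀ᵐ M ∂(goeStar d), M.IsHermitian ∧ M.trace = 0 := by
  have hm : MeasurableSet {M : Matrix (Fin d) (Fin d) ℝ | M.IsHermitian ∧ M.trace = 0} := by
    have : {M : Matrix (Fin d) (Fin d) ℝ | M.IsHermitian ∧ M.trace = 0}
        = (⋂ i, ⋂ j, {M | M j i = M i j}) ∩ {M | ∑ i, M i i = 0} := by
      ext M
      simp only [Set.mem_ofPred_eq, Set.mem_inter_iff, Set.mem_iInter, Matrix.IsHermitian,
        ← Matrix.ext_iff, Matrix.conjTranspose_apply, star_trivial, Matrix.trace, Matrix.diag_apply]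
    rw [this]
    exact (MeasurableSet.iInter fun i => MeasurableSet.iInter fun j =>
      measurableSet_eq_fun (measurable_matrix_entry j i) (measurable_matrix_entry i j)).inter
        (measurableSet_eq_fun (Finset.measurable_sum _ fun i _ => measurable_matrix_entry i i)
          measurable_const)
  rw [goeStar_eq_map, ae_map_iff (measurable_centeredReflection d).aemeasurable hm]
  refine Filter.Eventually.of_forall fun W => ⟨?_, ?_⟩
  · ext i j
    simp only [Matrix.conjTranspose_apply, star_trivial, centeredReflection_apply]
    rw [min_comm, max_comm]
    simp only [eq_comm]
  · simp only [Matrix.trace, Matrix.diag_apply, centeredReflection_apply, min_self, max_self,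
      if_true, mul_one, Finset.sum_sub_distrib, Finset.sum_const, Finset.card_univ,
      Fintype.card_fin, nsmul_eq_mul]
    field_simp
    simp

/-- This symmetry survives the truncation and removes odd moments when the truncated law is compared
with the full one. -/
theorem goeStar_map_neg (d : ℕ) : (goeStar d).map (fun M => -M) = goeStar d := by
  have hneg : Measurable fun M : Matrix (Fin d) (Fin d) ℝ => -M :=
    measurable_matrix_iff fun i j => (measurable_matrix_entry i j).neg
  have h1 : (gaussianArray d).map (fun W i j => -W i j) = gaussianArray d := by
    have h2 : ∀ i : Fin d, (Measure.pi fun j : Fin d =>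
        gaussianReal 0 (if i = j then 2 / (d : ℝ≥0) else 1 / (d : ℝ≥0))).map (fun w j => -w j)
        = Measure.pi fun j : Fin d =>
          gaussianReal 0 (if i = j then 2 / (d : ℝ≥0) else 1 / (d : ℝ≥0)) := by
      intro i
      have hm : ∀ j : Fin d, (gaussianReal 0
          (if i = j then 2 / (d : ℝ≥0) else 1 / (d : ℝ≥0))).map (fun x => -x)
          = gaussianReal 0 (if i = j then 2 / (d : ℝ≥0) else 1 / (d : ℝ≥0)) := fun j => by
        rw [gaussianReal_map_neg, neg_zero]
      have := Measure.pi_map_pi (μ := fun j : Fin d =>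
        gaussianReal 0 (if i = j then 2 / (d : ℝ≥0) else 1 / (d : ℝ≥0)))
        (f := fun _ x => -x) fun j => measurable_neg.aemeasurable
      rw [this]
      simp_rw [hm]
    have := Measure.pi_map_pi (μ := fun i : Fin d => Measure.pi fun j : Fin d =>
        gaussianReal 0 (if i = j then 2 / (d : ℝ≥0) else 1 / (d : ℝ≥0)))
        (f := fun _ w j => -w j) fun i => (by fun_prop : Measurable fun (w : Fin d → ℝ) j => -w j).aemeasurable
    rw [gaussianArray, this]
    simp_rw [h2]
  rw [goeStar_eq_map, Measure.map_map hneg (measurable_centeredReflection d)]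
  conv_rhs => rw [← h1]
  rw [Measure.map_map (measurable_centeredReflection d) (by fun_prop)]
  congr 1
  funext W
  ext i j
  simp only [Function.comp_apply, Matrix.neg_apply, centeredReflection_apply,
    Finset.sum_neg_distrib]
  ring

/-- Collecting both copies of each entry makes the pairing a linear form in the independent
upper-triangular variables. -/
theorem sum_symm_eq {d : ℕ} (S : Fin d → Fin d → ℝ) (W : Fin d → Fin d → ℝ) :
    ∑ i, ∑ j, S i j * W (min i j) (max i j)
      = ∑ i, ∑ j, (if i = j then S i j else if i < j then S i j + S j i else 0) * W i j := by
  have h1 : ∀ i j, S i j * W (min i j) (max i j)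
      = (if i = j then S i j else if i < j then S i j else 0) * W i j
        + (if j < i then S i j else 0) * W j i := by
    intro i j
    rcases lt_trichotomy i j with h | h | h
    · simp [h.ne, h, not_lt.2 h.le, min_eq_left h.le, max_eq_right h.le]
    · simp [h]
    · simp [h.ne', h, not_lt.2 h.le, min_eq_right h.le, max_eq_left h.le]
  simp_rw [h1, Finset.sum_add_distrib]
  rw [Finset.sum_comm (f := fun i j => (if j < i then S i j else 0) * W j i),
    ← Finset.sum_add_distrib]
  refine Finset.sum_congr rfl fun i _ => ?_
  rw [← Finset.sum_add_distrib]
  refine Finset.sum_congr rfl fun j _ => ?_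
  rcases lt_trichotomy i j with h | h | h
  · simp [h.ne, h]; ring
  · simp [h]
  · simp [h.ne', not_lt.2 h.le]

/-- The pairing with `S` is a centered Gaussian, so half its variance is the exponent. Off the
diagonal `(S_ij + S_ji)² ≤ 2 (S_ij² + S_ji²)`; on the diagonal the variance `2 / d` gives the same
weight. -/
theorem isSubGaussian_goeStar (d : ℕ) (hd : 0 < d) :
    IsSubGaussian (goeStar d) (vec (d := d)) (1 / d) := by
  have hd' : (0 : ℝ) < d := by exact_mod_cast hd
  have hmeas : ∀ S, Measurable fun M : Matrix (Fin d) (Fin d) ℝ => inner ℝ S (vec M) := by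
    intro S; simp only [inner_vec]; fun_prop
  refine ⟨hmeas, fun S => ?_⟩
  set s : ℝ := (∑ i, S (i, i)) / d with hs
  set c : Fin d → Fin d → ℝ := fun i j =>
    if i = j then S (i, j) - s else if i < j then S (i, j) + S (j, i) else 0 with hc
  have hsum : ∀ W, inner ℝ S (vec (centeredReflection d W)) = ∑ i, ∑ j, c i j * W i j := by
    intro W
    simp only [inner_vec, centeredReflection_apply, mul_sub, Finset.sum_sub_distrib]
    rw [sum_symm_eq (fun i j => S (i, j)) W]
    have : ∑ i, ∑ j, S (i, j) * ((∑ i, W i i) / d * if i = j then (1 : ℝ) else 0)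
        = ∑ i, ∑ j, (if i = j then s else 0) * W i j := by
      simp only [mul_ite, mul_one, mul_zero, ite_mul, zero_mul, Finset.sum_ite_eq,
        Finset.mem_univ, if_true]
      rw [← Finset.sum_mul, ← Finset.mul_sum, hs]
      ring
    rw [this, ← Finset.sum_sub_distrib]
    refine Finset.sum_congr rfl fun i _ => ?_
    rw [← Finset.sum_sub_distrib]
    refine Finset.sum_congr rfl fun j _ => ?_
    rw [← sub_mul, hc]
    dsimp only
    split_ifs <;> simp
  have hS' : Measurable fun M : Matrix (Fin d) (Fin d) ℝ =>
      ENNReal.ofReal (Real.exp (inner ℝ S (vec M))) :=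
    ENNReal.measurable_ofReal.comp (Real.measurable_exp.comp (hmeas S))
  rw [lintegral_goeStar d hS']
  have e : ∀ W, ENNReal.ofReal (Real.exp (inner ℝ S (vec (centeredReflection d W))))
      = ∏ i, ∏ j, ENNReal.ofReal (Real.exp (c i j * W i j)) := by
    intro W
    simp_rw [← ENNReal.ofReal_prod_of_nonneg fun i _ => (Real.exp_pos _).le, ← Real.exp_sum]
    rw [← ENNReal.ofReal_prod_of_nonneg fun i _ => (Real.exp_pos _).le, ← Real.exp_sum, hsum]
  simp_rw [e]
  rw [lintegral_gaussianArray_prod d (f := fun i j x => ENNReal.ofReal (Real.exp (c i j * x)))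
    fun i j => by fun_prop]
  simp_rw [lintegral_exp_mul_gaussianReal,
    ← ENNReal.ofReal_prod_of_nonneg fun i _ => (Real.exp_pos _).le, ← Real.exp_sum]
  rw [← ENNReal.ofReal_prod_of_nonneg fun i _ => (Real.exp_pos _).le, ← Real.exp_sum]
  refine ENNReal.ofReal_le_ofReal (Real.exp_le_exp.2 ?_)
  have hterm : ∀ i j, ((if i = j then 2 / (d : ℝ≥0) else 1 / (d : ℝ≥0) : ℝ≥0) : ℝ) * c i j ^ 2 / 2
      ≤ (if i = j then (S (i, j) - s) ^ 2 / d else 0)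
        + (if i < j then (S (i, j) ^ 2 + S (j, i) ^ 2) / d else 0) := by
    intro i j
    rcases lt_trichotomy i j with h | h | h
    · simp only [hc, h.ne, h, if_true, if_false, zero_add]
      push_cast
      rw [div_mul_eq_mul_div, div_div, div_le_div_iff₀ (by positivity) hd']
      nlinarith [mul_nonneg hd'.le (sq_nonneg (S (i, j) - S (j, i)))]
    · subst h
      simp only [hc, lt_irrefl, if_true, if_false, add_zero]
      push_cast
      apply le_of_eq; field_simp
    · simp [hc, h.ne', not_lt.2 h.le]
  refine (Finset.sum_le_sum fun i _ => Finset.sum_le_sum fun j _ => hterm i j).trans ?_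
  have hS : ‖S‖ ^ 2 = ∑ i, ∑ j, S (i, j) ^ 2 := by
    rw [EuclideanSpace.real_norm_sq_eq, Fintype.sum_prod_type]
  have hsplit : ∑ i, ∑ j, S (i, j) ^ 2 = ∑ i, S (i, i) ^ 2
      + ∑ i, ∑ j, (if i < j then S (i, j) ^ 2 + S (j, i) ^ 2 else 0) := by
    have h1 : ∀ i j : Fin d, S (i, j) ^ 2 = (if i = j then S (i, j) ^ 2 else 0)
        + (if i < j then S (i, j) ^ 2 else 0) + (if j < i then S (i, j) ^ 2 else 0) := by
      intro i j
      rcases lt_trichotomy i j with h | h | h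
      · simp [h.ne, h, not_lt.2 h.le]
      · simp [h]
      · simp [h.ne', h, not_lt.2 h.le]
    have h2 : ∑ i, ∑ j, S (i, j) ^ 2 = ∑ i, ∑ j, ((if i = j then S (i, j) ^ 2 else 0)
        + (if i < j then S (i, j) ^ 2 else 0) + (if j < i then S (i, j) ^ 2 else 0)) :=
      Finset.sum_congr rfl fun i _ => Finset.sum_congr rfl fun j _ => h1 i j
    rw [h2]
    simp_rw [Finset.sum_add_distrib]
    rw [Finset.sum_comm (f := fun i j => if j < i then S (i, j) ^ 2 else 0), add_assoc,
      ← Finset.sum_add_distrib (f := fun i => ∑ j, if i < j then S (i, j) ^ 2 else 0)]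
    congr 1
    · simp
    · refine Finset.sum_congr rfl fun i _ => ?_
      rw [← Finset.sum_add_distrib]
      exact Finset.sum_congr rfl fun j _ => by split_ifs <;> simp
  -- Removing the trace subtracts from the diagonal of `S` its mean, which only shrinks it.
  have hdiag : ∑ i, (S (i, i) - s) ^ 2 ≤ ∑ i, S (i, i) ^ 2 := by
    have h1 : ∑ i, (S (i, i) - s) ^ 2 = ∑ i, S (i, i) ^ 2 - d * s ^ 2 := by
      have : ∑ i, S (i, i) = d * s := by rw [hs]; field_simp
      simp_rw [sub_sq]
      rw [Finset.sum_add_distrib, Finset.sum_sub_distrib, ← Finset.sum_mul, ← Finset.mul_sum, this]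
      simp; ring
    have := mul_nonneg hd'.le (sq_nonneg s)
    linarith
  simp_rw [Finset.sum_add_distrib]
  rw [hS, hsplit, mul_add]
  refine add_le_add ?_ (le_of_eq ?_)
  · simp only [Finset.sum_ite_eq, Finset.mem_univ, if_true]
    rw [← Finset.sum_div, one_div, inv_mul_eq_div]
    gcongr
  · rw [Finset.mul_sum]
    refine Finset.sum_congr rfl fun i _ => ?_
    rw [Finset.mul_sum]
    refine Finset.sum_congr rfl fun j _ => ?_
    split_ifs <;> ring

/-- The lower tail of the Frobenius norm. -/
theorem goeStar_frobenius_lt (d : ℕ) (hd : 50 ≤ d) :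
    goeStar d {M | ‖vec M‖ ^ 2 < d / 4} ≤ ENNReal.ofReal (1 / 4) := by
  have hd' : (50 : ℝ) ≤ d := by exact_mod_cast hd
  have hdpos : (0 : ℝ) < d := by linarith
  -- Chernoff bound using only entries above the diagonal, which the centering does not touch. The
  -- rate `3d / 2` makes each factor `(1 + 3)^(-1/2) = 1 / 2`, and `3d² / 16` is this rate times `d
  -- / 8`, half of the threshold `d / 4`.
  set f : Matrix (Fin d) (Fin d) ℝ → ℝ≥0∞ := fun M =>
    ENNReal.ofReal (Real.exp (3 * d ^ 2 / 16)) * ∏ i, ∏ j, ENNReal.ofReal (Real.exp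
      ((if i < j then -(3 * (d : ℝ) / 2) else 0) * M i j ^ 2)) with hf
  have hfm : Measurable f := by
    rw [hf]
    refine Measurable.const_mul (Finset.measurable_prod _ fun i _ =>
      Finset.measurable_prod _ fun j _ => ?_) _
    fun_prop
  have hsub : {M : Matrix (Fin d) (Fin d) ℝ | ‖vec M‖ ^ 2 < d / 4 ∧ M.IsHermitian}
      ⊆ {M | 1 ≤ f M} := by
    rintro M ⟨hM, hH⟩
    simp only [Set.mem_ofPred_eq, hf]
    simp_rw [← ENNReal.ofReal_prod_of_nonneg fun i _ => (Real.exp_pos _).le, ← Real.exp_sum]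
    rw [← ENNReal.ofReal_prod_of_nonneg fun i _ => (Real.exp_pos _).le, ← Real.exp_sum,
      ← ENNReal.ofReal_mul (Real.exp_pos _).le, ← Real.exp_add, ENNReal.one_le_ofReal,
      Real.one_le_exp_iff]
    have h1 : ∑ i, ∑ j, (if i < j then -(3 * (d : ℝ) / 2) else 0) * M i j ^ 2
        = -(3 * (d : ℝ) / 2) * ∑ i, ∑ j, if i < j then M i j ^ 2 else 0 := by
      rw [Finset.mul_sum]
      refine Finset.sum_congr rfl fun i _ => ?_
      rw [Finset.mul_sum]
      exact Finset.sum_congr rfl fun j _ => by split_ifs <;> simp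
    have h2 : 2 * ∑ i, ∑ j, (if i < j then M i j ^ 2 else 0) ≤ ‖vec M‖ ^ 2 := by
      rw [norm_vec_sq, two_mul]
      nth_rewrite 2 [Finset.sum_comm]
      rw [← Finset.sum_add_distrib]
      refine Finset.sum_le_sum fun i _ => ?_
      rw [← Finset.sum_add_distrib]
      refine Finset.sum_le_sum fun j _ => ?_
      have hij : M j i = M i j := hH.apply i j
      rcases lt_trichotomy i j with h | h | h
      · simp [h, not_lt.2 h.le]
      · simp [h, sq_nonneg]
      · simp [h, not_lt.2 h.le, hij]
    rw [h1]
    nlinarith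
  have h1 : goeStar d {M | ‖vec M‖ ^ 2 < d / 4}
      = goeStar d {M | ‖vec M‖ ^ 2 < d / 4 ∧ M.IsHermitian} := by
    refine measure_congr ?_
    filter_upwards [goeStar_symm_traceless d (by omega)] with M hM
    exact propext ⟨fun h => ⟨h, hM.1⟩, fun h => h.1⟩
  rw [h1]
  have h2 := mul_meas_ge_le_lintegral (μ := goeStar d) hfm 1
  rw [one_mul] at h2
  refine (measure_mono hsub).trans (h2.trans ?_)
  rw [lintegral_goeStar d hfm]
  have e : ∀ W, f (centeredReflection d W) = ENNReal.ofReal (Real.exp (3 * d ^ 2 / 16))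
      * ∏ i, ∏ j, ENNReal.ofReal (Real.exp ((if i < j then -(3 * (d : ℝ) / 2) else 0) * W i j ^ 2)) := by
    intro W
    simp only [hf]
    congr 1
    refine Finset.prod_congr rfl fun i _ => Finset.prod_congr rfl fun j _ => ?_
    by_cases h : i < j
    · rw [centeredReflection_apply, if_neg h.ne, min_eq_left h.le, max_eq_right h.le]; simp
    · simp [h]
  simp_rw [e]
  have hm : ∀ i j : Fin d, Measurable fun x : ℝ =>
      ENNReal.ofReal (Real.exp ((if i < j then -(3 * (d : ℝ) / 2) else 0) * x ^ 2)) := by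
    intro i j; fun_prop
  rw [lintegral_const_mul _ (by fun_prop), lintegral_gaussianArray_prod d hm]
  have e2 : ∀ i j : Fin d, ∫⁻ x, ENNReal.ofReal (Real.exp
      ((if i < j then -(3 * (d : ℝ) / 2) else 0) * x ^ 2))
      ∂(gaussianReal 0 (if i = j then 2 / (d : ℝ≥0) else 1 / (d : ℝ≥0)))
      = ENNReal.ofReal (Real.exp (if i < j then -Real.log 2 else 0)) := by
    intro i j
    by_cases h : i < j
    · rw [if_pos h, if_neg h.ne, if_pos h, lintegral_exp_mul_sq_gaussianReal]
      · congr 1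
        rw [Real.exp_neg, Real.exp_log two_pos]
        push_cast
        have : 1 / (1 - 2 * -(3 * (d : ℝ) / 2) * (1 / d)) = (2⁻¹ : ℝ) ^ 2 := by
          field_simp; norm_num
        rw [this, Real.sqrt_sq (by norm_num)]
      · simp; omega
      · push_cast
        field_simp; norm_num
    · simp [h]
  simp_rw [e2, ← ENNReal.ofReal_prod_of_nonneg fun i _ => (Real.exp_pos _).le, ← Real.exp_sum]
  rw [← ENNReal.ofReal_prod_of_nonneg fun i _ => (Real.exp_pos _).le, ← Real.exp_sum,
    ← ENNReal.ofReal_mul (Real.exp_pos _).le, ← Real.exp_add]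
  refine ENNReal.ofReal_le_ofReal ?_
  have hcount : ∑ i : Fin d, ∑ j : Fin d, (if i < j then -Real.log 2 else 0)
      = -Real.log 2 * (d * (d - 1) / 2) := by
    have h3 : ∀ i : Fin d, ∑ j : Fin d, (if i < j then -Real.log 2 else 0)
        = -Real.log 2 * ((d : ℝ) - 1 - i) := by
      intro i
      rw [← Finset.sum_filter, Finset.sum_const, nsmul_eq_mul]
      have : Finset.univ.filter (fun j => i < j) = Finset.Ioi i := by ext; simp
      rw [this, Fin.card_Ioi]
      have := i.2
      rw [Nat.cast_sub (by omega), Nat.cast_sub (by omega)]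
      push_cast; ring
    simp_rw [h3]
    rw [← Finset.mul_sum, Finset.sum_sub_distrib, Fin.sum_univ_eq_sum_range (fun i => (i : ℝ)) d]
    congr 1
    have h4 := Finset.sum_range_id_mul_two d
    have h5 : (∑ i ∈ Finset.range d, (i : ℝ)) * 2 = d * (d - 1) := by
      have := congrArg (Nat.cast (R := ℝ)) h4
      push_cast at this
      rw [this, Nat.cast_sub (by omega)]; simp
    simp
    linarith
  rw [hcount]
  have hlog := Real.log_two_gt_d9
  have hexp : 3 * (d : ℝ) ^ 2 / 16 + -Real.log 2 * (d * (d - 1) / 2) ≤ -3 := by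
    have : 0.69 * ((d : ℝ) * (d - 1) / 2) ≤ Real.log 2 * (d * (d - 1) / 2) := by
      refine mul_le_mul_of_nonneg_right (by linarith) ?_
      have : (0 : ℝ) ≤ d - 1 := by linarith
      positivity
    nlinarith
  calc Real.exp _ ≤ Real.exp (-3) := Real.exp_le_exp.2 hexp
    _ ≤ 1 / 4 := by
      rw [Real.exp_neg, inv_le_comm₀ (Real.exp_pos _) (by norm_num)]
      have := Real.add_one_le_exp (3 : ℝ)
      norm_num at this ⊢
      linarith

end GOE

/-! ### Upper tail of the operator norm -/

section OperatorNorm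

variable {d : ℕ}

theorem inner_toEuclideanCLM (M : Matrix (Fin d) (Fin d) ℝ) (x y : EuclideanSpace ℝ (Fin d)) :
    inner ℝ x (Matrix.toEuclideanCLM (𝕜 := ℝ) M y) = ∑ i, ∑ j, x i * M i j * y j := by
  rw [PiLp.inner_apply]
  refine Finset.sum_congr rfl fun i _ => ?_
  have : (Matrix.toEuclideanCLM (𝕜 := ℝ) M y) i = ∑ j, M i j * y j := by
    rw [Matrix.ofLp_toEuclideanCLM]; rfl
  rw [this]
  simp only [RCLike.inner_apply, conj_trivial, Finset.sum_mul]
  exact Finset.sum_congr rfl fun j _ => by ring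

/-- A Hermitian matrix has a unit vector near which its quadratic form is large in absolute value:
the eigenvector of the dominant eigenvalue. -/
theorem exists_dominant_vector [NeZero d] {M : Matrix (Fin d) (Fin d) ℝ} (hM : M.IsHermitian) :
    ∃ (v : EuclideanSpace ℝ (Fin d)) (σ : ℝ), ‖v‖ = 1 ∧ (σ = 1 ∨ σ = -1) ∧
      ∀ x, ‖x‖ ^ 2 ≤ 2 * inner ℝ v x ^ 2 → opNorm M * (2 * inner ℝ v x ^ 2 - ‖x‖ ^ 2)
        ≤ σ * inner ℝ x (Matrix.toEuclideanCLM (𝕜 := ℝ) M x) := by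
  set u := hM.eigenvectorBasis with hu
  set l := hM.eigenvalues with hl
  set T := Matrix.toEuclideanCLM (𝕜 := ℝ) M with hT
  obtain ⟨k, -, hk⟩ := Finset.exists_max_image (Finset.univ : Finset (Fin d)) (fun i => |l i|)
    ⟨0, Finset.mem_univ _⟩
  have hTu : ∀ i, T (u i) = l i • u i := by
    intro i
    have := hM.mulVec_eigenvectorBasis i
    ext j
    have h2 := congrFun this j
    rw [hT, Matrix.ofLp_toEuclideanCLM]; exact h2
  have hsym : ∀ x y, inner ℝ x (T y) = inner ℝ y (T x) := by
    intro x y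
    rw [inner_toEuclideanCLM, inner_toEuclideanCLM, Finset.sum_comm]
    refine Finset.sum_congr rfl fun i _ => Finset.sum_congr rfl fun j _ => ?_
    have : M j i = M i j := hM.apply i j
    rw [this]; ring
  have hc : ∀ i x, inner ℝ (u i) (T x) = l i * inner ℝ (u i) x := by
    intro i x
    rw [hsym, hTu, inner_smul_right, real_inner_comm]
  have hpars : ∀ x, ∑ i, inner ℝ (u i) x ^ 2 = ‖x‖ ^ 2 := by
    intro x
    have := u.sum_sq_norm_inner_right x
    simpa only [Real.norm_eq_abs, sq_abs] using this
  have hop : opNorm M ≤ |l k| := by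
    refine ContinuousLinearMap.opNorm_le_bound _ (abs_nonneg _) fun x => ?_
    refine abs_le_of_sq_le_sq' ?_ (by positivity) |>.2
    rw [mul_pow, ← hpars x, ← hpars (T x), sq_abs, Finset.mul_sum]
    refine Finset.sum_le_sum fun i _ => ?_
    rw [hc, mul_pow]
    have := sq_le_sq.2 (hk i (Finset.mem_univ i))
    gcongr
  have hq : ∀ x, inner ℝ x (T x) = ∑ i, l i * inner ℝ (u i) x ^ 2 := by
    intro x
    rw [← u.sum_inner_mul_inner x (T x)]
    refine Finset.sum_congr rfl fun i _ => ?_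
    rw [hc, real_inner_comm]; ring
  obtain ⟨σ, hσ, hσk⟩ : ∃ σ : ℝ, (σ = 1 ∨ σ = -1) ∧ σ * l k = |l k| := by
    rcases abs_choice (l k) with h | h
    · exact ⟨1, Or.inl rfl, by rw [h, one_mul]⟩
    · exact ⟨-1, Or.inr rfl, by rw [h]; ring⟩
  refine ⟨u k, σ, u.norm_eq_one k, hσ, fun x hx => ?_⟩
  have h1 : |l k| * (2 * inner ℝ (u k) x ^ 2 - ‖x‖ ^ 2) ≤ σ * inner ℝ x (T x) := by
    rw [hq, ← hpars x, Finset.mul_sum, ← Finset.add_sum_erase _ _ (Finset.mem_univ k),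
      ← Finset.add_sum_erase _ (fun i => σ * _) (Finset.mem_univ k)]
    have h2 : -(|l k| * ∑ i ∈ Finset.univ.erase k, inner ℝ (u i) x ^ 2)
        ≤ ∑ i ∈ Finset.univ.erase k, σ * (l i * inner ℝ (u i) x ^ 2) := by
      rw [Finset.mul_sum, ← Finset.sum_neg_distrib]
      refine Finset.sum_le_sum fun i _ => ?_
      have h3 := hk i (Finset.mem_univ i)
      have h4 : |σ * l i| ≤ |l k| := by
        rcases hσ with rfl | rfl <;> simpa using h3
      have h5 := neg_le_of_abs_le h4
      nlinarith [sq_nonneg (inner ℝ (u i) x)]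
    have h6 : σ * (l k * inner ℝ (u k) x ^ 2) = |l k| * inner ℝ (u k) x ^ 2 := by
      rw [← mul_assoc, hσk]
    linarith
  exact (mul_le_mul_of_nonneg_right hop (sub_nonneg.2 hx)).trans h1

/-- The quadratic form of `M` at `x / ‖x‖`, scaled by `a`, is the pairing of `M` with this vector. -/
def rankOne (a : ℝ) (x : EuclideanSpace ℝ (Fin d)) : EuclideanSpace ℝ (Fin d × Fin d) :=
  WithLp.toLp 2 fun p => a / ‖x‖ ^ 2 * (x p.1 * x p.2)

theorem inner_rankOne (a : ℝ) (x : EuclideanSpace ℝ (Fin d)) (M : Matrix (Fin d) (Fin d) ℝ) :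
    inner ℝ (rankOne a x) (vec M)
      = a / ‖x‖ ^ 2 * inner ℝ x (Matrix.toEuclideanCLM (𝕜 := ℝ) M x) := by
  rw [inner_vec, inner_toEuclideanCLM, Finset.mul_sum]
  refine Finset.sum_congr rfl fun i _ => ?_
  rw [Finset.mul_sum]
  refine Finset.sum_congr rfl fun j _ => ?_
  simp only [rankOne]
  ring

theorem norm_rankOne_sq_le (a : ℝ) (x : EuclideanSpace ℝ (Fin d)) : ‖rankOne a x‖ ^ 2 ≤ a ^ 2 := by
  have h1 : ‖rankOne a x‖ ^ 2 = (a / ‖x‖ ^ 2) ^ 2 * (‖x‖ ^ 2 * ‖x‖ ^ 2) := by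
    have h2 : ‖x‖ ^ 2 * ‖x‖ ^ 2 = ∑ i, ∑ j, x i ^ 2 * x j ^ 2 := by
      rw [EuclideanSpace.real_norm_sq_eq x, Finset.sum_mul_sum]
    rw [EuclideanSpace.real_norm_sq_eq, Fintype.sum_prod_type, h2, Finset.mul_sum]
    refine Finset.sum_congr rfl fun i _ => ?_
    rw [Finset.mul_sum]
    exact Finset.sum_congr rfl fun j _ => by simp only [rankOne]; ring
  rw [h1]
  by_cases hx : ‖x‖ = 0
  · rw [hx]; simp [sq_nonneg]
  · apply le_of_eq; field_simp

/-- A ball of radius `1/5` about `4/5 v` is seen from the origin within an angle of sine `1/4` from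
`v`. There `2 cos² - 1 ≥ 7/8`, so the Rayleigh quotient keeps `7/8` of the operator norm in absolute
value, and `21/8 = 3 · 7/8`. -/
theorem le_abs_rankOne [NeZero d] {M : Matrix (Fin d) (Fin d) ℝ} (hM : M.IsHermitian)
    (h3 : 3 < opNorm M) {a : ℝ} (ha : 0 ≤ a) :
    ∃ v : EuclideanSpace ℝ (Fin d), ‖v‖ = 1 ∧ ∀ x ∈ Metric.closedBall ((4 / 5 : ℝ) • v) (1 / 5),
      ‖x‖ ≤ 1 ∧ a * (21 / 8) ≤ |inner ℝ (rankOne a x) (vec M)| := by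
  obtain ⟨v, σ, hv, hσ, h⟩ := exists_dominant_vector hM
  refine ⟨v, hv, fun x hx => ?_⟩
  rw [mem_closedBall_iff_norm] at hx
  have hnv : ‖(4 / 5 : ℝ) • v‖ = 4 / 5 := by rw [norm_smul, hv]; norm_num
  have h1 : ‖x‖ ≤ 1 := by
    have := norm_le_norm_add_norm_sub' x ((4 / 5 : ℝ) • v)
    linarith
  have h2 : 3 / 5 ≤ ‖x‖ := by
    have := norm_sub_norm_le ((4 / 5 : ℝ) • v) x
    rw [norm_sub_rev] at this
    linarith
  have h4 : ‖x‖ ^ 2 ≤ 8 / 5 * inner ℝ v x - 3 / 5 := by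
    have h5 : ‖x - (4 / 5 : ℝ) • v‖ ^ 2 ≤ (1 / 5) ^ 2 := by gcongr
    rw [norm_sub_sq_real, hnv, inner_smul_right, real_inner_comm] at h5
    nlinarith
  have h6 : 7 / 8 * ‖x‖ ^ 2 ≤ 2 * inner ℝ v x ^ 2 - ‖x‖ ^ 2 := by
    nlinarith [sq_nonneg (inner ℝ v x - 3 / 4)]
  have h7 := h x (by nlinarith [sq_nonneg ‖x‖])
  have h8 : 21 / 8 * ‖x‖ ^ 2 ≤ |inner ℝ x (Matrix.toEuclideanCLM (𝕜 := ℝ) M x)| := by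
    have h9 : σ * inner ℝ x (Matrix.toEuclideanCLM (𝕜 := ℝ) M x)
        ≤ |inner ℝ x (Matrix.toEuclideanCLM (𝕜 := ℝ) M x)| := by
      rcases hσ with rfl | rfl
      · rw [one_mul]; exact le_abs_self _
      · rw [neg_one_mul]; exact neg_le_abs _
    nlinarith [sq_nonneg ‖x‖]
  refine ⟨h1, ?_⟩
  rw [inner_rankOne, abs_mul, abs_of_nonneg (by positivity)]
  have hpos : 0 < ‖x‖ ^ 2 := by positivity
  calc a * (21 / 8) = a / ‖x‖ ^ 2 * (21 / 8 * ‖x‖ ^ 2) := by field_simp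
    _ ≤ _ := by gcongr

/-- The upper tail of the operator norm. -/
theorem goeStar_three_lt_opNorm (d : ℕ) (hd : 50 ≤ d) :
    goeStar d {M | 3 < opNorm M} ≤ ENNReal.ofReal (1 / 4) := by
  have : NeZero d := ⟨by omega⟩
  have hd' : (50 : ℝ) ≤ d := by exact_mod_cast hd
  have hdpos : (0 : ℝ) < d := by linarith
  -- This `a` minimises `a² / d - 21 a / 8`; the minimum is `-(441 / 256) d`.
  set a : ℝ := 21 / 16 * d with ha
  have hsub := isSubGaussian_goeStar d (by omega)
  set B : Set (EuclideanSpace ℝ (Fin d)) := Metric.closedBall 0 1 with hB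
  set F : Matrix (Fin d) (Fin d) ℝ → EuclideanSpace ℝ (Fin d) → ℝ≥0∞ := fun M x =>
    ENNReal.ofReal (Real.exp (inner ℝ (rankOne a x) (vec M)))
      + ENNReal.ofReal (Real.exp (inner ℝ (rankOne (-a) x) (vec M))) with hF
  have hFm : Measurable (Function.uncurry F) := by
    have h1 : ∀ b : ℝ, Measurable fun p : Matrix (Fin d) (Fin d) ℝ × EuclideanSpace ℝ (Fin d) =>
        inner ℝ (rankOne b p.2) (vec p.1) := by
      intro b
      simp only [inner_vec, rankOne]
      refine Finset.measurable_sum _ fun i _ => Finset.measurable_sum _ fun j _ =>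
        Measurable.mul (by fun_prop) ((measurable_matrix_entry i j).comp measurable_fst)
    exact (ENNReal.measurable_ofReal.comp (Real.measurable_exp.comp (h1 a))).add
      (ENNReal.measurable_ofReal.comp (Real.measurable_exp.comp (h1 (-a))))
  -- Averaging the exponential of the Rayleigh quotient over the unit ball takes the place of a
  -- union bound over a net. A large operator norm forces `Φ` to be large on a ball with a fraction
  -- `5^(-d)` of the volume. Both signs are included because the dominant eigenvalue may be
  -- negative.
  set Φ : Matrix (Fin d) (Fin d) ℝ → ℝ≥0∞ := fun M => ∫⁻ x in B, F M x with hΦ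
  have hΦm : Measurable Φ := hFm.lintegral_prod_right'
  have hΦle : ∫⁻ M, Φ M ∂(goeStar d) ≤ ENNReal.ofReal (2 * Real.exp (a ^ 2 / d)) * volume B := by
    rw [hΦ, lintegral_lintegral_swap hFm.aemeasurable]
    calc ∫⁻ x in B, ∫⁻ M, F M x ∂(goeStar d)
        ≤ ∫⁻ x in B, ENNReal.ofReal (2 * Real.exp (a ^ 2 / d)) := by
          refine lintegral_mono fun x => ?_
          have h1 : ∀ b : ℝ, b ^ 2 = a ^ 2 →
              ∫⁻ M, ENNReal.ofReal (Real.exp (inner ℝ (rankOne b x) (vec M))) ∂(goeStar d)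
                ≤ ENNReal.ofReal (Real.exp (a ^ 2 / d)) := by
            intro b hb
            refine (hsub.lintegral_le _).trans (ENNReal.ofReal_le_ofReal (Real.exp_le_exp.2 ?_))
            rw [one_div, inv_mul_eq_div, ← hb]
            exact div_le_div_of_nonneg_right (norm_rankOne_sq_le b x) hdpos.le
          simp only [hF]
          have hm : Measurable fun M : Matrix (Fin d) (Fin d) ℝ =>
              ENNReal.ofReal (Real.exp (inner ℝ (rankOne a x) (vec M))) :=
            ENNReal.measurable_ofReal.comp (Real.measurable_exp.comp (hsub.measurable _))
          rw [lintegral_add_left hm, two_mul, ENNReal.ofReal_add (Real.exp_pos _).le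
            (Real.exp_pos _).le]
          exact add_le_add (h1 a rfl) (h1 (-a) (neg_sq a))
      _ = _ := by rw [lintegral_const, Measure.restrict_apply_univ]
  set δ : ℝ≥0∞ := ENNReal.ofReal (Real.exp (a * (21 / 8)) * (1 / 5) ^ d) * volume B with hδ
  have hincl : {M : Matrix (Fin d) (Fin d) ℝ | 3 < opNorm M ∧ M.IsHermitian} ⊆ {M | δ ≤ Φ M} := by
    rintro M ⟨h3, hM⟩
    obtain ⟨v, hv, h⟩ := le_abs_rankOne hM h3 (a := a) (by positivity)
    set D := Metric.closedBall ((4 / 5 : ℝ) • v) (1 / 5 : ℝ) with hD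
    have hDB : D ⊆ B := fun x hx => mem_closedBall_zero_iff.2 (h x hx).1
    show δ ≤ Φ M
    calc δ = ∫⁻ x in D, ENNReal.ofReal (Real.exp (a * (21 / 8))) := by
          rw [lintegral_const, Measure.restrict_apply_univ, hδ, hD, hB,
            Measure.addHaar_closedBall _ _ (by norm_num : (0 : ℝ) ≤ 1 / 5),
            Measure.addHaar_closedBall _ _ (zero_le_one), finrank_euclideanSpace_fin,
            ENNReal.ofReal_mul (Real.exp_pos _).le]
          simp [mul_assoc]
      _ ≤ ∫⁻ x in D, F M x := by
          refine setLIntegral_mono' Metric.isClosed_closedBall.measurableSet fun x hx => ?_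
          have h1 := (h x hx).2
          have hneg : inner ℝ (rankOne (-a) x) (vec M) = -inner ℝ (rankOne a x) (vec M) := by
            rw [inner_rankOne, inner_rankOne]; ring
          rcases le_abs.1 h1 with h2 | h2
          · exact le_add_right (ENNReal.ofReal_le_ofReal (Real.exp_le_exp.2 h2))
          · refine le_add_left (ENNReal.ofReal_le_ofReal (Real.exp_le_exp.2 ?_))
            rw [hneg]; exact h2
      _ ≤ Φ M := lintegral_mono_set hDB
  have h1 : goeStar d {M | 3 < opNorm M} = goeStar d {M | 3 < opNorm M ∧ M.IsHermitian} := by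
    refine measure_congr ?_
    filter_upwards [goeStar_symm_traceless d (by omega)] with M hM
    exact propext ⟨fun h => ⟨h, hM.1⟩, fun h => h.1⟩
  rw [h1]
  have h2 := (mul_meas_ge_le_lintegral (μ := goeStar d) hΦm δ).trans hΦle
  have h3 := (mul_le_mul_right (measure_mono (μ := goeStar d) hincl) δ).trans h2
  have hV0 : volume B ≠ 0 := (Metric.measure_closedBall_pos _ _ one_pos).ne'
  have hVt : volume B ≠ ⊤ := measure_closedBall_lt_top.ne
  rw [hδ, mul_right_comm] at h3
  have h4 := (ENNReal.mul_le_mul_iff_left hV0 hVt).1 h3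
  have hpos : 0 < Real.exp (a * (21 / 8)) * (1 / 5) ^ d := by positivity
  rw [mul_comm, ← ENNReal.le_div_iff_mul_le (Or.inl (by simpa using hpos))
    (Or.inl ENNReal.ofReal_ne_top), ← ENNReal.ofReal_div_of_pos hpos] at h4
  refine h4.trans (ENNReal.ofReal_le_ofReal ?_)
  -- The exponential gain per dimension must beat the volume loss `5`: the ratio is at least `10 /
  -- 9`, and its `d`-th power exceeds `8`, giving probability `2 / 8`.
  have he : (50 / 9 : ℝ) ≤ Real.exp (441 / 256) := by
    have h5 : Real.exp (441 / 256) = Real.exp 1 * Real.exp (185 / 256) := by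
      rw [← Real.exp_add]; norm_num
    have h6 := Real.exp_one_gt_d9
    have h7 := Real.sum_le_exp_of_nonneg (x := 185 / 256) (by norm_num) 5
    simp only [Finset.sum_range_succ, Finset.sum_range_zero, Nat.factorial] at h7
    norm_num at h7
    rw [h5]
    nlinarith
  rw [div_le_iff₀ hpos]
  have h8 : Real.exp (a * (21 / 8)) = Real.exp (a ^ 2 / d) * Real.exp (441 / 256) ^ d := by
    rw [← Real.exp_nat_mul, ← Real.exp_add]
    congr 1
    rw [ha]; field_simp; ring
  rw [h8, mul_assoc, ← mul_pow]
  have h9 : (8 : ℝ) ≤ (Real.exp (441 / 256) * (1 / 5)) ^ d := by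
    calc (8 : ℝ) ≤ (10 / 9) ^ 50 := by norm_num
      _ ≤ (10 / 9) ^ d := pow_le_pow_right₀ (by norm_num) hd
      _ ≤ _ := pow_le_pow_left₀ (by norm_num) (by linarith) d
  nlinarith [Real.exp_pos (a ^ 2 / d)]

end OperatorNorm

/-! ### The truncated ensemble -/

section Truncation

variable {d : ℕ}

theorem norm_vec_sq_eq_trace (M : Matrix (Fin d) (Fin d) ℝ) :
    ‖vec M‖ ^ 2 = (M.conjTranspose * M).trace := by
  rw [norm_vec_sq, Finset.sum_comm, Matrix.trace]
  refine Finset.sum_congr rfl fun j _ => ?_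
  rw [Matrix.diag_apply, Matrix.mul_apply]
  exact Finset.sum_congr rfl fun i _ => by simp [sq]

theorem eigenvalues_le_opNorm_sq (M : Matrix (Fin d) (Fin d) ℝ) (i : Fin d) :
    (Matrix.isHermitian_conjTranspose_mul_self M).eigenvalues i ≤ opNorm M ^ 2 := by
  set H := Matrix.isHermitian_conjTranspose_mul_self M with hH
  set v := H.eigenvectorBasis i with hv
  have hv1 : ‖v‖ = 1 := H.eigenvectorBasis.norm_eq_one i
  have h1 : H.eigenvalues i = ‖Matrix.toEuclideanCLM (𝕜 := ℝ) M v‖ ^ 2 := by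
    rw [H.eigenvalues_eq, ← Matrix.mulVec_mulVec, Matrix.dotProduct_mulVec,
      Matrix.vecMul_conjTranspose, star_star, EuclideanSpace.real_norm_sq_eq]
    simp only [Matrix.ofLp_toEuclideanCLM, dotProduct, Pi.star_apply, star_trivial,
      RCLike.re_to_real]
    exact Finset.sum_congr rfl fun j _ => by rw [sq]
  rw [h1]
  have h2 := (Matrix.toEuclideanCLM (𝕜 := ℝ) M).le_opNorm v
  rw [hv1, mul_one] at h2
  exact pow_le_pow_left₀ (norm_nonneg _) h2 2

theorem opNorm_nonneg (M : Matrix (Fin d) (Fin d) ℝ) : 0 ≤ opNorm M := norm_nonneg _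

/-- Each squared singular value is at most the largest one times itself. This converts the Frobenius
bound `d / 4` into the trace-norm bound `d / 12`. -/
theorem norm_vec_sq_le_traceNorm {M : Matrix (Fin d) (Fin d) ℝ} (h : opNorm M ≤ 3) :
    ‖vec M‖ ^ 2 ≤ 3 * traceNorm M := by
  set H := Matrix.isHermitian_conjTranspose_mul_self M with hH
  have h1 := H.trace_eq_sum_eigenvalues
  simp only [RCLike.ofReal_real_eq_id, id] at h1
  rw [norm_vec_sq_eq_trace, h1, traceNorm, Finset.mul_sum]
  refine Finset.sum_le_sum fun i _ => ?_
  have h0 : 0 ≤ H.eigenvalues i :=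
    (Matrix.posSemidef_conjTranspose_mul_self M).eigenvalues_nonneg i
  have h2 := eigenvalues_le_opNorm_sq M i
  have h3 : √(H.eigenvalues i) ≤ 3 := by
    rw [Real.sqrt_le_left (by norm_num)]
    have := opNorm_nonneg M
    nlinarith
  calc H.eigenvalues i = √(H.eigenvalues i) * √(H.eigenvalues i) := (Real.mul_self_sqrt h0).symm
    _ ≤ 3 * √(H.eigenvalues i) := by gcongr

theorem norm_vec_sq_le_opNorm (M : Matrix (Fin d) (Fin d) ℝ) :
    ‖vec M‖ ^ 2 ≤ d * opNorm M ^ 2 := by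
  have h1 := (Matrix.isHermitian_conjTranspose_mul_self M).trace_eq_sum_eigenvalues
  simp only [RCLike.ofReal_real_eq_id, id] at h1
  rw [norm_vec_sq_eq_trace, h1]
  refine (Finset.sum_le_sum fun i _ => eigenvalues_le_opNorm_sq M i).trans ?_
  simp

theorem opNorm_neg (M : Matrix (Fin d) (Fin d) ℝ) : opNorm (-M) = opNorm M := by
  simp [opNorm]

theorem traceNorm_neg (M : Matrix (Fin d) (Fin d) ℝ) : traceNorm (-M) = traceNorm M := by
  -- The eigenvalues depend on the proof of hermiticity, so the equality of the two Gram matrices is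
  -- substituted with both proofs generalised.
  have : ∀ {A B : Matrix (Fin d) (Fin d) ℝ} (hA : A.IsHermitian) (hB : B.IsHermitian), A = B →
      ∑ i, √(hA.eigenvalues i) = ∑ i, √(hB.eigenvalues i) := by
    rintro A B hA hB rfl; rfl
  exact this _ _ (by simp)

theorem measurable_opNorm : Measurable (opNorm (d := d)) := by
  have h : Continuous (opNorm (d := d)) :=
    continuous_norm.comp (LinearMap.continuous_of_finiteDimensional
      ((Matrix.toEuclideanCLM (n := Fin d) (𝕜 := ℝ)).toAlgEquiv.toLinearMap))
  exact h.measurable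

/-- Failure of either condition lies in one of two events of probability at most `1 / 4`: operator
norm above `3`, or squared Frobenius norm below `d / 4`. The term with `C` only enlarges the event.
-/
theorem half_le_goeStar_truncEvent {C : ℝ} (hC : 0 ≤ C) (m : ℕ) (hd : 50 ≤ d) :
    ENNReal.ofReal (1 / 2) ≤ goeStar d (truncEvent C m d) := by
  have hd' : (50 : ℝ) ≤ d := by exact_mod_cast hd
  have hsub : (Set.univ : Set (Matrix (Fin d) (Fin d) ℝ)) ⊆ truncEvent C m d
      ∪ ({M | 3 < opNorm M} ∪ {M | ‖vec M‖ ^ 2 < d / 4}) := by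
    intro M _
    by_cases h1 : 3 < opNorm M
    · exact Or.inr (Or.inl h1)
    by_cases h2 : ‖vec M‖ ^ 2 < d / 4
    · exact Or.inr (Or.inr h2)
    left
    rw [not_lt] at h1 h2
    refine ⟨h1.trans (le_add_of_nonneg_right (by positivity)), ?_⟩
    have := norm_vec_sq_le_traceNorm h1
    linarith
  have h1 := (measure_mono (μ := goeStar d) hsub).trans
    ((measure_union_le _ _).trans (add_le_add le_rfl (measure_union_le _ _)))
  rw [measure_univ (μ := goeStar d)] at h1
  have h2 : (1 : ℝ≥0∞) ≤ goeStar d (truncEvent C m d) + ENNReal.ofReal (1 / 2) := by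
    refine h1.trans (add_le_add le_rfl ?_)
    refine (add_le_add (goeStar_three_lt_opNorm d hd) (goeStar_frobenius_lt d hd)).trans ?_
    rw [← ENNReal.ofReal_add (by norm_num) (by norm_num)]
    exact ENNReal.ofReal_le_ofReal (by norm_num)
  have h3 : (1 : ℝ≥0∞) = ENNReal.ofReal (1 / 2) + ENNReal.ofReal (1 / 2) := by
    rw [← ENNReal.ofReal_add (by norm_num) (by norm_num)]; norm_num
  rw [h3] at h2
  exact (ENNReal.add_le_add_iff_right ENNReal.ofReal_ne_top).1 h2

theorem isProbabilityMeasure_goeStarTrunc {C : ℝ} (hC : 0 ≤ C) (m : ℕ) (hd : 50 ≤ d) :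
    IsProbabilityMeasure (goeStarTrunc d (truncEvent C m d)) := by
  refine cond_isProbabilityMeasure fun h => ?_
  have := half_le_goeStar_truncEvent hC m hd
  rw [h] at this
  norm_num at this

/-- The density of a conditioned law is at most the inverse probability of the event. -/
theorem goeStarTrunc_le {C : ℝ} (hC : 0 ≤ C) (m : ℕ) (hd : 50 ≤ d) :
    goeStarTrunc d (truncEvent C m d) ≤ (2 : ℝ≥0∞) • goeStar d := by
  rw [goeStarTrunc, ProbabilityTheory.cond]
  refine Measure.le_iff.2 fun s _ => ?_
  simp only [Measure.smul_apply, smul_eq_mul]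
  refine mul_le_mul' ?_ (Measure.restrict_apply_le _ _)
  have := half_le_goeStar_truncEvent hC m hd
  rw [ENNReal.inv_le_iff_inv_le]
  refine le_trans (le_of_eq ?_) this
  rw [one_div, ENNReal.ofReal_inv_of_pos two_pos]; simp

theorem goeStarTrunc_ae (C : ℝ) (m : ℕ) (hd : 50 ≤ d) :
    ∀ᵐ M ∂(goeStarTrunc d (truncEvent C m d)),
      M.trace = 0 ∧ opNorm M ≤ 3 + C * √(Real.log m / d) := by
  have h1 : ∀ᵐ M ∂(goeStarTrunc d (truncEvent C m d)), M.trace = 0 := by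
    have : goeStarTrunc d (truncEvent C m d) ≪ goeStar d := cond_absolutelyContinuous
    exact this.ae_le ((goeStar_symm_traceless d (by omega)).mono fun M h => h.2)
  have h2 : ∀ᵐ M ∂(goeStarTrunc d (truncEvent C m d)), opNorm M ≤ 3 + C * √(Real.log m / d) := by
    rw [goeStarTrunc, ProbabilityTheory.cond]
    refine Measure.ae_smul_measure ?_ _
    have hm : MeasurableSet {M : Matrix (Fin d) (Fin d) ℝ | opNorm M ≤ 3 + C * √(Real.log m / d)} :=
      measurableSet_le measurable_opNorm measurable_const
    -- Only the operator-norm half of the event is used, as a measurable superset; measurability of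
    -- the trace norm is not needed.
    exact ae_restrict_of_ae_restrict_of_subset (fun M hM => hM.1) (ae_restrict_mem hm)
  exact h1.and h2

theorem goeStarTrunc_map_neg (C : ℝ) (m : ℕ) :
    (goeStarTrunc d (truncEvent C m d)).map (fun M => -M) = goeStarTrunc d (truncEvent C m d) := by
  have hneg : Measurable fun M : Matrix (Fin d) (Fin d) ℝ => -M :=
    measurable_matrix_iff fun i j => (measurable_matrix_entry i j).neg
  -- For a measurable equivalence, restriction commutes with the push-forward without measurability
  -- of the event.
  let e : Matrix (Fin d) (Fin d) ℝ ≃ᵐ Matrix (Fin d) (Fin d) ℝ :=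
    { Equiv.neg _ with measurable_toFun := hneg, measurable_invFun := hneg }
  have he : (⇑e : Matrix (Fin d) (Fin d) ℝ → _) = fun M => -M := rfl
  have hU : e ⁻¹' (truncEvent C m d) = truncEvent C m d := by
    ext M
    simp only [Set.mem_preimage, he, truncEvent, Set.mem_ofPred_eq, opNorm_neg, traceNorm_neg]
  have h1 := e.restrict_map (goeStar d) (truncEvent C m d)
  rw [hU, he, goeStar_map_neg] at h1
  rw [goeStarTrunc, ProbabilityTheory.cond, Measure.map_smul, ← h1]

/-- A density bound alone would leave a factor `2` in front, which is useless for small `S`. By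
symmetry the moment is `1 + E (cosh f - 1)` with a nonnegative integrand, so doubling the density
turns `E` into at most `1 + 2 (E - 1) ≤ E²`. -/
theorem isSubGaussian_goeStarTrunc {C : ℝ} (hC : 0 ≤ C) (m : ℕ) (hd : 50 ≤ d) :
    IsSubGaussian (goeStarTrunc d (truncEvent C m d)) (vec (d := d)) (2 / d) := by
  have hG := isSubGaussian_goeStar d (by omega)
  have := isProbabilityMeasure_goeStarTrunc hC m hd
  refine ⟨hG.measurable, fun S => ?_⟩
  set ν := goeStarTrunc d (truncEvent C m d) with hν
  set f : Matrix (Fin d) (Fin d) ℝ → ℝ := fun M => inner ℝ S (vec M) with hf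
  have hfm : Measurable f := hG.measurable S
  have hfneg : ∀ M, f (-M) = -f M := by
    intro M
    simp only [hf, inner_vec, Matrix.neg_apply, mul_neg, Finset.sum_neg_distrib]
  have hexp : Measurable fun M => ENNReal.ofReal (Real.exp (f M)) :=
    ENNReal.measurable_ofReal.comp (Real.measurable_exp.comp hfm)
  have hcosh : ∀ t : ℝ, ENNReal.ofReal (Real.exp t) + ENNReal.ofReal (Real.exp (-t))
      = 2 * (1 + ENNReal.ofReal (Real.cosh t - 1)) := by
    intro t
    have h1 := Real.one_le_cosh t
    rw [← ENNReal.ofReal_one, ← ENNReal.ofReal_add zero_le_one (by linarith),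
      ← ENNReal.ofReal_add (Real.exp_pos _).le (Real.exp_pos _).le,
      show (2 : ℝ≥0∞) = ENNReal.ofReal 2 by simp, ← ENNReal.ofReal_mul two_pos.le, Real.cosh_eq]
    congr 1; ring
  have hhm : Measurable fun M => ENNReal.ofReal (Real.cosh (f M) - 1) :=
    ENNReal.measurable_ofReal.comp ((Real.measurable_cosh.comp hfm).sub_const 1)
  have hsymm : ∀ κ : Measure (Matrix (Fin d) (Fin d) ℝ), IsProbabilityMeasure κ →
      κ.map (fun M => -M) = κ → ∫⁻ M, ENNReal.ofReal (Real.exp (f M)) ∂κ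
        = 1 + ∫⁻ M, ENNReal.ofReal (Real.cosh (f M) - 1) ∂κ := by
    intro κ _ hκ
    have hneg : Measurable fun M : Matrix (Fin d) (Fin d) ℝ => -M :=
      measurable_matrix_iff fun i j => (measurable_matrix_entry i j).neg
    have h1 : ∫⁻ M, ENNReal.ofReal (Real.exp (f M)) ∂κ
        = ∫⁻ M, ENNReal.ofReal (Real.exp (-f M)) ∂κ := by
      conv_lhs => rw [← hκ]
      rw [lintegral_map hexp hneg]
      simp_rw [hfneg]
    have h2 : 2 * ∫⁻ M, ENNReal.ofReal (Real.exp (f M)) ∂κ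
        = 2 * (1 + ∫⁻ M, ENNReal.ofReal (Real.cosh (f M) - 1) ∂κ) := by
      rw [two_mul]
      nth_rewrite 2 [h1]
      rw [← lintegral_add_left hexp]
      simp_rw [hcosh]
      rw [lintegral_const_mul _ (by fun_prop), lintegral_add_left measurable_const]
      simp
    exact (ENNReal.mul_right_inj two_ne_zero ENNReal.ofNat_ne_top).1 h2
  have h1 := hsymm (goeStar d) inferInstance (goeStar_map_neg d)
  have h2 := hsymm ν inferInstance (goeStarTrunc_map_neg C m)
  have h3 := hG.lintegral_le S
  set E := Real.exp (1 / d * ‖S‖ ^ 2) with hE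
  have hE1 : 1 ≤ E := Real.one_le_exp (by positivity)
  have h4 : ∫⁻ M, ENNReal.ofReal (Real.cosh (f M) - 1) ∂(goeStar d) ≤ ENNReal.ofReal (E - 1) := by
    have h5 : (1 : ℝ≥0∞) + ∫⁻ M, ENNReal.ofReal (Real.cosh (f M) - 1) ∂(goeStar d)
        ≤ 1 + ENNReal.ofReal (E - 1) := by
      rw [← h1]
      refine h3.trans (le_of_eq ?_)
      rw [← ENNReal.ofReal_one, ← ENNReal.ofReal_add zero_le_one (by linarith)]
      congr 1; ring
    exact (ENNReal.add_le_add_iff_left ENNReal.one_ne_top).1 h5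
  rw [h2]
  have h6 : ∫⁻ M, ENNReal.ofReal (Real.cosh (f M) - 1) ∂ν ≤ 2 * ENNReal.ofReal (E - 1) := by
    refine (lintegral_mono' (goeStarTrunc_le hC m hd) le_rfl).trans ?_
    rw [lintegral_smul_measure, smul_eq_mul]
    gcongr
  calc 1 + ∫⁻ M, ENNReal.ofReal (Real.cosh (f M) - 1) ∂ν
      ≤ 1 + 2 * ENNReal.ofReal (E - 1) := by gcongr
    _ = ENNReal.ofReal (1 + 2 * (E - 1)) := by
        rw [ENNReal.ofReal_add zero_le_one (by linarith), ENNReal.ofReal_mul two_pos.le]; simp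
    _ ≤ ENNReal.ofReal (Real.exp (2 / d * ‖S‖ ^ 2)) := by
        refine ENNReal.ofReal_le_ofReal ?_
        have : Real.exp (2 / d * ‖S‖ ^ 2) = E ^ 2 := by
          rw [hE, ← Real.exp_nat_mul]; congr 1; push_cast; ring
        rw [this]
        nlinarith [sq_nonneg (E - 1)]

end Truncation

/-! ### Real effects and their normalised vectors -/

section RealEffect

variable {D : ℕ}

/-- A real positive semidefinite matrix, given by a factorisation. -/
def IsEffect (F : Matrix (Fin D) (Fin D) ℝ) : Prop :=
  ∃ (k : Type) (_ : Fintype k) (β : k → Fin D → ℝ), ∀ i j, F i j = ∑ l, β l i * β l j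

namespace IsEffect

variable {F : Matrix (Fin D) (Fin D) ℝ}

theorem sum_mul_mul_eq {k : Type} [Fintype k] {β : k → Fin D → ℝ}
    (h : ∀ i j, F i j = ∑ l, β l i * β l j) (x : Fin D → ℝ) :
    ∑ i, ∑ j, x i * F i j * x j = ∑ l, (∑ i, x i * β l i) ^ 2 := by
  simp_rw [sq, Finset.sum_mul_sum]
  rw [Finset.sum_comm (s := (Finset.univ : Finset k))]
  refine Finset.sum_congr rfl fun i _ => ?_
  rw [Finset.sum_comm]
  refine Finset.sum_congr rfl fun j _ => ?_
  rw [h, Finset.mul_sum, Finset.sum_mul]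
  exact Finset.sum_congr rfl fun l _ => by ring

theorem symm (hF : IsEffect F) (i j : Fin D) : F i j = F j i := by
  obtain ⟨k, _, β, h⟩ := hF
  rw [h, h]
  exact Finset.sum_congr rfl fun l _ => mul_comm _ _

theorem diag_nonneg (hF : IsEffect F) (i : Fin D) : 0 ≤ F i i := by
  obtain ⟨k, _, β, h⟩ := hF
  rw [h]
  exact Finset.sum_nonneg fun l _ => mul_self_nonneg _

theorem trace_nonneg (hF : IsEffect F) : 0 ≤ F.trace :=
  Finset.sum_nonneg fun i _ => hF.diag_nonneg i

/-- The duality of trace and operator norm, from summing quadratic forms over a factorisation of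
`F`. It keeps the perturbed outcome probabilities nonnegative. -/
theorem abs_inner_le (hF : IsEffect F) (M : Matrix (Fin D) (Fin D) ℝ) :
    |inner ℝ (vec F) (vec M)| ≤ opNorm M * F.trace := by
  obtain ⟨k, _, β, h⟩ := hF
  have h1 : inner ℝ (vec F) (vec M) = ∑ l, inner ℝ (WithLp.toLp 2 (β l))
      (Matrix.toEuclideanCLM (𝕜 := ℝ) M (WithLp.toLp 2 (β l))) := by
    simp_rw [inner_vec, inner_toEuclideanCLM]
    rw [Finset.sum_comm (s := (Finset.univ : Finset k))]
    refine Finset.sum_congr rfl fun i _ => ?_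
    rw [Finset.sum_comm]
    refine Finset.sum_congr rfl fun j _ => ?_
    rw [show (vec F) (i, j) = F i j from rfl, h, Finset.sum_mul]
    exact Finset.sum_congr rfl fun l _ => by ring
  have h2 : F.trace = ∑ l, ‖(WithLp.toLp 2 (β l) : EuclideanSpace ℝ (Fin D))‖ ^ 2 := by
    simp_rw [EuclideanSpace.real_norm_sq_eq, Matrix.trace, Matrix.diag_apply, h]
    rw [Finset.sum_comm]
    exact Finset.sum_congr rfl fun l _ => Finset.sum_congr rfl fun i _ => (sq _).symm
  rw [h1, h2, Finset.mul_sum]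
  refine (Finset.abs_sum_le_sum_abs _ _).trans (Finset.sum_le_sum fun l _ => ?_)
  refine (abs_real_inner_le_norm _ _).trans ?_
  have := (Matrix.toEuclideanCLM (𝕜 := ℝ) M).le_opNorm (WithLp.toLp 2 (β l))
  calc _ ≤ ‖(WithLp.toLp 2 (β l) : EuclideanSpace ℝ (Fin D))‖
        * (opNorm M * ‖(WithLp.toLp 2 (β l) : EuclideanSpace ℝ (Fin D))‖) := by
        gcongr; exact this
    _ = _ := by ring

theorem norm_vec_sq_le (hF : IsEffect F) : ‖vec F‖ ^ 2 ≤ F.trace ^ 2 := by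
  obtain ⟨k, _, β, h⟩ := hF
  rw [norm_vec_sq, sq, Matrix.trace, Finset.sum_mul_sum]
  refine Finset.sum_le_sum fun i _ => Finset.sum_le_sum fun j _ => ?_
  rw [Matrix.diag_apply, Matrix.diag_apply, h, h, h]
  have := Finset.sum_mul_sq_le_sq_mul_sq Finset.univ (fun l => β l i) fun l => β l j
  simpa only [sq] using this

/-- Cauchy-Schwarz for `Tr (Bᵀ (B Xᵀ))` with `F = Bᵀ B`. The right-hand side is linear in `F` apart
from the trace factor, so it can be summed over a measurement. -/
theorem inner_sq_le (hF : IsEffect F) (X : EuclideanSpace ℝ (Fin D × Fin D)) :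
    inner ℝ (vec F) X ^ 2 ≤ F.trace * ∑ i, ∑ j, ∑ l, X (i, j) * F j l * X (i, l) := by
  obtain ⟨k, _, β, h⟩ := hF
  have h1 : inner ℝ (vec F) X
      = ∑ p : k × Fin D, β p.1 p.2 * ∑ j, X (p.2, j) * β p.1 j := by
    rw [real_inner_comm, inner_vec, Fintype.sum_prod_type, Finset.sum_comm (s := (Finset.univ : Finset k))]
    refine Finset.sum_congr rfl fun i _ => ?_
    simp_rw [Finset.mul_sum]
    rw [Finset.sum_comm]
    refine Finset.sum_congr rfl fun j _ => ?_
    rw [h, Finset.mul_sum]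
    exact Finset.sum_congr rfl fun l _ => by ring
  have h2 : F.trace = ∑ p : k × Fin D, β p.1 p.2 ^ 2 := by
    simp_rw [Fintype.sum_prod_type, Matrix.trace, Matrix.diag_apply, h]
    rw [Finset.sum_comm]
    exact Finset.sum_congr rfl fun l _ => Finset.sum_congr rfl fun i _ => (sq _).symm
  have h3 : ∑ i, ∑ j, ∑ l, X (i, j) * F j l * X (i, l)
      = ∑ p : k × Fin D, (∑ j, X (p.2, j) * β p.1 j) ^ 2 := by
    rw [Fintype.sum_prod_type, Finset.sum_comm (s := (Finset.univ : Finset k))]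
    exact Finset.sum_congr rfl fun i _ => sum_mul_mul_eq h fun j => X (i, j)
  rw [h1, h2, h3]
  exact Finset.sum_mul_sq_le_sq_mul_sq _ _ _

end IsEffect

/-- The effect scaled to have Frobenius norm at most the square root of its trace. -/
def scaledVec (F : Matrix (Fin D) (Fin D) ℝ) : EuclideanSpace ℝ (Fin D × Fin D) :=
  (√F.trace)⁻¹ • vec F

/-- An effect of trace zero vanishes, so the inverse of zero in the normalisation does no harm. -/
theorem IsEffect.vec_eq (F : Matrix (Fin D) (Fin D) ℝ) (hF : IsEffect F) :
    vec F = √F.trace • scaledVec F := by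
  rcases hF.trace_nonneg.eq_or_lt with h | h
  · have := hF.norm_vec_sq_le
    rw [← h] at this
    have h0 : vec F = 0 := by
      rw [← norm_eq_zero, ← sq_eq_zero_iff]
      nlinarith [sq_nonneg ‖vec F‖]
    rw [scaledVec, h0]; simp
  · rw [scaledVec, smul_smul, mul_inv_cancel₀ (Real.sqrt_pos.2 h).ne', one_smul]

theorem IsEffect.norm_scaledVec_sq_le {F : Matrix (Fin D) (Fin D) ℝ} (hF : IsEffect F) :
    ‖scaledVec F‖ ^ 2 ≤ F.trace := by
  rw [scaledVec, norm_smul, mul_pow, Real.norm_eq_abs, sq_abs, inv_pow,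
    Real.sq_sqrt hF.trace_nonneg]
  rcases hF.trace_nonneg.eq_or_lt with h | h
  · rw [← h]; simp
  · rw [inv_mul_le_iff₀ h, ← sq]
    exact hF.norm_vec_sq_le

/-- The adjoint statement is a Bessel inequality: the squared pairing of each vector with `w` is at
most `Tr (w F_z wᵀ)`, and these sum to `‖w‖²` because the effects sum to the identity. Testing it on
the combination itself gives the claim. -/
theorem norm_sum_scaledVec_le {r : ℕ} {F : Fin r → Matrix (Fin D) (Fin D) ℝ}
    (hF : ∀ z, IsEffect (F z)) (h1 : ∑ z, F z = 1) (v : Fin r → ℝ) :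
    ‖∑ z, v z • scaledVec (F z)‖ ^ 2 ≤ ∑ z, v z ^ 2 := by
  set w := ∑ z, v z • scaledVec (F z) with hw
  have hz : ∀ z, inner ℝ (scaledVec (F z)) w ^ 2
      ≤ ∑ i, ∑ j, ∑ l, w (i, j) * F z j l * w (i, l) := by
    intro z
    have h2 := (hF z).inner_sq_le w
    rw [scaledVec, inner_smul_left, mul_pow]
    simp only [conj_trivial, inv_pow]
    rw [Real.sq_sqrt (hF z).trace_nonneg]
    rcases (hF z).trace_nonneg.eq_or_lt with h | h
    · rw [← h, inv_zero, zero_mul]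
      obtain ⟨k, _, β, hβ⟩ := hF z
      refine Finset.sum_nonneg fun i _ => ?_
      rw [IsEffect.sum_mul_mul_eq hβ fun j => w (i, j)]
      positivity
    · rwa [inv_mul_le_iff₀ h]
  have hsum : ∑ z, ∑ i, ∑ j, ∑ l, w (i, j) * F z j l * w (i, l) = ‖w‖ ^ 2 := by
    rw [EuclideanSpace.real_norm_sq_eq, Fintype.sum_prod_type, Finset.sum_comm]
    refine Finset.sum_congr rfl fun i _ => ?_
    rw [Finset.sum_comm]
    refine Finset.sum_congr rfl fun j _ => ?_
    rw [Finset.sum_comm]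
    have : ∀ l, ∑ z, w (i, j) * F z j l * w (i, l)
        = w (i, j) * (if j = l then 1 else 0) * w (i, l) := by
      intro l
      rw [← Finset.sum_mul, ← Finset.mul_sum, ← Matrix.sum_apply, h1, Matrix.one_apply]
    simp_rw [this]
    simp [sq]
  have h2 : ‖w‖ ^ 2 = ∑ z, v z * inner ℝ (scaledVec (F z)) w := by
    rw [← real_inner_self_eq_norm_sq]
    conv_lhs => rw [hw, sum_inner]
    exact Finset.sum_congr rfl fun z _ => by
      rw [inner_smul_left, conj_trivial]
  have h3 := Finset.sum_mul_sq_le_sq_mul_sq Finset.univ v fun z => inner ℝ (scaledVec (F z)) w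
  rw [← h2] at h3
  have h4 : ∑ z, inner ℝ (scaledVec (F z)) w ^ 2 ≤ ‖w‖ ^ 2 :=
    (Finset.sum_le_sum fun z _ => hz z).trans hsum.le
  have h5 : (‖w‖ ^ 2) ^ 2 ≤ (∑ z, v z ^ 2) * ‖w‖ ^ 2 :=
    h3.trans (mul_le_mul_of_nonneg_left h4 (by positivity))
  rcases (sq_nonneg ‖w‖).eq_or_lt with h | h
  · rw [← h]; positivity
  · rw [sq (‖w‖ ^ 2)] at h5
    exact le_of_mul_le_mul_right h5 h

theorem sum_norm_scaledVec_le {r : ℕ} {F : Fin r → Matrix (Fin D) (Fin D) ℝ}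
    (hF : ∀ z, IsEffect (F z)) (h1 : ∑ z, F z = 1) :
    ∑ z, ‖scaledVec (F z)‖ ^ 2 ≤ D := by
  refine (Finset.sum_le_sum fun z _ => (hF z).norm_scaledVec_sq_le).trans (le_of_eq ?_)
  rw [← Matrix.trace_sum, h1]; simp

end RealEffect

/-! ### One block: the measurement bounds for the perturbed state -/

namespace Task

variable {m : ℕ} (T : Task m)

/-- The real part of the `ν`-th diagonal block. -/
def realBlock (E : Matrix T.Index T.Index ℂ) (ν : Fin m) :
    Matrix (Fin (T.dim ν)) (Fin (T.dim ν)) ℝ :=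
  Matrix.of fun i j => (E ⟨ν, i⟩ ⟨ν, j⟩).re

variable {T}

/-- The real part of `v v*` is `(Re v)(Re v)ᵀ + (Im v)(Im v)ᵀ`, hence the doubled index set. -/
theorem isEffect_realBlock {E : Matrix T.Index T.Index ℂ} (hE : E.PosSemidef) (ν : Fin m) :
    IsEffect (T.realBlock E ν) := by
  obtain ⟨k, v, hv⟩ := Matrix.posSemidef_iff_eq_sum_vecMulVec.1 hE
  refine ⟨Fin k ⊕ Fin k, inferInstance,
    Sum.elim (fun l i => (v l ⟨ν, i⟩).re) (fun l i => (v l ⟨ν, i⟩).im), fun i j => ?_⟩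
  rw [Fintype.sum_sum_type, ← Finset.sum_add_distrib, realBlock, Matrix.of_apply, hv,
    Matrix.sum_apply, Complex.re_sum]
  exact Finset.sum_congr rfl fun l _ => by simp [Matrix.vecMulVec_apply, Complex.mul_re]

theorem sum_realBlock {r : ℕ} (M : POVM T.Index r) (ν : Fin m) :
    ∑ z, T.realBlock (M.elem z) ν = 1 := by
  ext i j
  have h := congrFun (congrFun M.sum_eq_one ⟨ν, i⟩) ⟨ν, j⟩
  rw [Matrix.sum_apply] at h
  rw [Matrix.sum_apply]
  simp only [realBlock, Matrix.of_apply]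
  rw [← Complex.re_sum, h, Matrix.one_apply, Matrix.one_apply]
  by_cases hij : i = j <;> simp [hij]

/-- The state is real and block diagonal, so only the real parts of the diagonal blocks of a complex
effect contribute. -/
theorem outcomeProb_perturbedState (N : (ν : Fin m) → Matrix (Fin (T.dim ν)) (Fin (T.dim ν)) ℝ)
    {E : Matrix T.Index T.Index ℂ} (hE : E.PosSemidef) :
    outcomeProb (T.perturbedState N) E = 1 / T.d * ∑ ν,
      (∑ i, T.a ν i * T.realBlock E ν i i + T.eps ν * inner ℝ (vec (T.realBlock E ν)) (vec (N ν))) := by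
  have h1 : ∀ ν, (∑ i, T.a ν i * T.realBlock E ν i i
      + T.eps ν * inner ℝ (vec (T.realBlock E ν)) (vec (N ν)))
      = ∑ i, ∑ j, (Matrix.diagonal (T.a ν) + T.eps ν • N ν) i j * T.realBlock E ν j i := by
    intro ν
    rw [inner_vec, Finset.mul_sum, ← Finset.sum_add_distrib]
    refine Finset.sum_congr rfl fun i _ => ?_
    simp only [Matrix.add_apply, Matrix.smul_apply, smul_eq_mul, add_mul, Finset.sum_add_distrib,
      Matrix.diagonal_apply, ite_mul, zero_mul, Finset.sum_ite_eq, Finset.mem_univ, if_true]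
    rw [Finset.mul_sum]
    congr 1
    refine Finset.sum_congr rfl fun j _ => ?_
    rw [(isEffect_realBlock hE ν).symm j i]
    simp only [vec]
    ring
  simp_rw [h1]
  rw [outcomeProb, Matrix.trace, Complex.re_sum, Fintype.sum_sigma, Finset.mul_sum]
  refine Finset.sum_congr rfl fun ν _ => ?_
  rw [Finset.mul_sum]
  refine Finset.sum_congr rfl fun i _ => ?_
  rw [Matrix.diag_apply, Matrix.mul_apply, Complex.re_sum, Fintype.sum_sigma, Finset.mul_sum,
    Finset.sum_eq_single ν]
  · refine Finset.sum_congr rfl fun j _ => ?_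
    simp only [perturbedState, Matrix.map_apply, Matrix.smul_apply, Matrix.blockDiagonal'_apply_eq,
      Complex.re_ofReal_mul, realBlock, Matrix.of_apply, smul_eq_mul, mul_assoc]
  · intro μ _ hμ
    refine Finset.sum_eq_zero fun j _ => ?_
    simp only [perturbedState, Matrix.map_apply, Matrix.smul_apply,
      Matrix.blockDiagonal'_apply, dif_neg hμ.symm]
    simp
  · simp

/-- Perturbations of block `ν` that keep the trace and the positivity of the state. -/
def IsAdmissible (ν : Fin m) (M : Matrix (Fin (T.dim ν)) (Fin (T.dim ν)) ℝ) : Prop :=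
  M.trace = 0 ∧ T.eps ν * opNorm M ≤ T.d * (2 : ℝ) ^ (-T.j ν)

theorem isAdmissible_zero (ν : Fin m) :
    IsAdmissible (T := T) ν (0 : Matrix (Fin (T.dim ν)) (Fin (T.dim ν)) ℝ) :=
  ⟨by simp, by simp [opNorm]; positivity⟩

theorem le_sum_diag {E : Matrix T.Index T.Index ℂ} (hE : E.PosSemidef) (ν : Fin m) :
    T.d * (2 : ℝ) ^ (-T.j ν) * (T.realBlock E ν).trace ≤ ∑ i, T.a ν i * T.realBlock E ν i i := by
  rw [Matrix.trace, Finset.mul_sum]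
  exact Finset.sum_le_sum fun i _ =>
    mul_le_mul_of_nonneg_right (T.a_mem ν i).1 ((isEffect_realBlock hE ν).diag_nonneg i)

theorem block_nonneg {E : Matrix T.Index T.Index ℂ} (hE : E.PosSemidef) {ν : Fin m}
    {M : Matrix (Fin (T.dim ν)) (Fin (T.dim ν)) ℝ} (hM : T.IsAdmissible ν M) :
    0 ≤ ∑ i, T.a ν i * T.realBlock E ν i i + T.eps ν * inner ℝ (vec (T.realBlock E ν)) (vec M) := by
  have h1 := le_sum_diag hE ν
  have h2 := (isEffect_realBlock hE ν).abs_inner_le M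
  have h3 := neg_le_of_abs_le h2
  have h4 := mul_le_mul_of_nonneg_left h3 (T.eps_pos ν).le
  have h5 := mul_le_mul_of_nonneg_right hM.2 (isEffect_realBlock hE ν).trace_nonneg
  nlinarith

variable {N : (ν : Fin m) → Matrix (Fin (T.dim ν)) (Fin (T.dim ν)) ℝ}

theorem outcomeProb_nonneg (hN : ∀ ν, T.IsAdmissible ν (N ν)) {E : Matrix T.Index T.Index ℂ}
    (hE : E.PosSemidef) : 0 ≤ outcomeProb (T.perturbedState N) E := by
  rw [outcomeProb_perturbedState N hE]
  exact mul_nonneg (by positivity) (Finset.sum_nonneg fun ν _ => block_nonneg hE (hN ν))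

theorem sum_outcomeProb (hd : 0 < T.d) (hN : ∀ ν, (N ν).trace = 0) {r : ℕ} (M : POVM T.Index r) :
    ∑ z, outcomeProb (T.perturbedState N) (M.elem z) = 1 := by
  have h1 : ∑ z, outcomeProb (T.perturbedState N) (M.elem z)
      = outcomeProb (T.perturbedState N) 1 := by
    simp only [outcomeProb]
    rw [← Complex.re_sum, ← Matrix.trace_sum, ← Finset.mul_sum, M.sum_eq_one]
  have hd' : (T.d : ℝ) ≠ 0 := by positivity
  have h2 : ∀ ν, T.realBlock 1 ν = 1 := by
    intro ν; ext i j
    simp only [realBlock, Matrix.of_apply, Matrix.one_apply]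
    by_cases hij : i = j <;> simp [hij]
  rw [h1, outcomeProb_perturbedState N Matrix.PosSemidef.one]
  have h3 : ∀ ν, inner ℝ (vec (T.realBlock 1 ν)) (vec (N ν)) = 0 := by
    intro ν
    rw [h2, inner_vec, ← hN ν, Matrix.trace]
    refine Finset.sum_congr rfl fun i _ => ?_
    simp [vec, Matrix.one_apply]
  simp_rw [h3, h2]
  simp only [Matrix.one_apply_eq, mul_one, mul_zero, add_zero]
  rw [T.sum_a, d]
  rw [d] at hd'
  field_simp

theorem measurable_outcomeProb {X : Type*} [MeasurableSpace X]
    {N : X → (ν : Fin m) → Matrix (Fin (T.dim ν)) (Fin (T.dim ν)) ℝ} (hN : Measurable N)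
    (E : Matrix T.Index T.Index ℂ) : Measurable fun x => outcomeProb (T.perturbedState (N x)) E := by
  simp only [outcomeProb, Matrix.trace, Matrix.diag_apply, Matrix.mul_apply]
  refine Complex.measurable_re.comp (Finset.measurable_sum _ fun p _ =>
    Finset.measurable_sum _ fun q _ => Measurable.mul_const ?_ _)
  simp only [perturbedState, Matrix.map_apply, Matrix.smul_apply, smul_eq_mul]
  refine Complex.measurable_ofReal.comp (Measurable.const_mul ?_ _)
  obtain ⟨ν, i⟩ := p
  obtain ⟨μ, j⟩ := q
  by_cases h : ν = μ
  · subst h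
    simp only [Matrix.blockDiagonal'_apply_eq, Matrix.add_apply, Matrix.smul_apply, smul_eq_mul]
    exact measurable_const.add (Measurable.const_mul
      ((measurable_matrix_entry i j).comp ((measurable_pi_apply ν).comp hN)) _)
  · simp only [Matrix.blockDiagonal'_apply, dif_neg h]
    exact measurable_const

/-- The squared size of the effect of block `ν` on the outcome probabilities. -/
def strength (T : Task m) (ν : Fin m) : ℝ := T.eps ν ^ 2 * (2 : ℝ) ^ T.j ν / (T.d : ℝ) ^ 2

/-- The increment of an outcome probability is `ε_ν / d · √(Tr F)` times a pairing with the
normalised effect. The reference probability is at least `2^{-j_ν} Tr F`, so the trace cancels in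
the chi-square quotient and leaves `strength ν` times the squared pairing. The other blocks are
arbitrary admissible matrices, as the hybrid requires. -/
theorem stepBound {C : ℝ} (hC : 0 ≤ C) (ν : Fin m) (hdim : 50 ≤ T.dim ν)
    (hN : ∀ μ, T.IsAdmissible μ (N μ))
    (hU : T.eps ν * (3 + C * √(Real.log m / T.dim ν)) ≤ T.d * (2 : ℝ) ^ (-T.j ν)) :
    StepBound (goeStarTrunc (T.dim ν) (truncEvent C m (T.dim ν)))
      (fun M => T.perturbedState (Function.update N ν M))
      (T.perturbedState (Function.update N ν 0))
      (8 * T.strength ν / T.dim ν) (8 * T.strength ν) := by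
  have hdimpos : (0 : ℝ) < T.dim ν := by
    have : (50 : ℝ) ≤ T.dim ν := by exact_mod_cast hdim
    linarith
  have hdpos : 0 < T.d :=
    (by omega : 0 < T.dim ν).trans_le
      (Finset.single_le_sum (f := T.dim) (fun _ _ => Nat.zero_le _) (Finset.mem_univ ν))
  have hd0 : (0 : ℝ) < T.d := by exact_mod_cast hdpos
  have := isProbabilityMeasure_goeStarTrunc hC m hdim
  have hsub := isSubGaussian_goeStarTrunc hC m hdim
  set κ := goeStarTrunc (T.dim ν) (truncEvent C m (T.dim ν)) with hκ
  have hae : ∀ᵐ M ∂κ, T.IsAdmissible ν M ∧ ‖vec M‖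
      ≤ √(T.dim ν * (3 + C * √(Real.log m / T.dim ν)) ^ 2) := by
    filter_upwards [goeStarTrunc_ae C m hdim] with M hM
    refine ⟨⟨hM.1, ?_⟩, ?_⟩
    · exact (mul_le_mul_of_nonneg_left hM.2 (T.eps_pos ν).le).trans hU
    · refine Real.le_sqrt_of_sq_le ((norm_vec_sq_le_opNorm M).trans ?_)
      have := opNorm_nonneg M
      gcongr
      exact hM.2
  have hup : ∀ {M}, T.IsAdmissible ν M → ∀ μ, T.IsAdmissible μ (Function.update N ν M μ) := by
    intro M hM μ
    by_cases h : μ = ν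
    · subst h; simpa using hM
    · rw [Function.update_of_ne h]; exact hN μ
  set τ : ℝ := (2 : ℝ) ^ (-T.j ν) with hτ
  have hτpos : 0 < τ := by positivity
  have hstr : T.strength ν = (T.eps ν / T.d) ^ 2 / τ := by
    rw [strength, hτ, Real.rpow_neg two_pos.le]
    field_simp
  have hstr0 : 0 ≤ T.strength ν := by rw [hstr]; positivity
  have hdiff : ∀ {E : Matrix T.Index T.Index ℂ}, E.PosSemidef → ∀ M,
      outcomeProb (T.perturbedState (Function.update N ν M)) E
        = outcomeProb (T.perturbedState (Function.update N ν 0)) E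
          + T.eps ν / T.d * √(T.realBlock E ν).trace
            * inner ℝ (scaledVec (T.realBlock E ν)) (vec M) := by
    intro E hE M
    have h1 : ∀ X : Matrix (Fin (T.dim ν)) (Fin (T.dim ν)) ℝ,
        ∑ μ, (∑ i, T.a μ i * T.realBlock E μ i i
          + T.eps μ * inner ℝ (vec (T.realBlock E μ)) (vec (Function.update N ν X μ)))
        = (∑ i, T.a ν i * T.realBlock E ν i i
          + T.eps ν * inner ℝ (vec (T.realBlock E ν)) (vec X))
          + ∑ μ ∈ Finset.univ.erase ν, (∑ i, T.a μ i * T.realBlock E μ i i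
            + T.eps μ * inner ℝ (vec (T.realBlock E μ)) (vec (N μ))) := by
      intro X
      rw [← Finset.add_sum_erase _ _ (Finset.mem_univ ν), Function.update_self]
      congr 1
      refine Finset.sum_congr rfl fun μ hμ => ?_
      rw [Function.update_of_ne (Finset.ne_of_mem_erase hμ)]
    rw [outcomeProb_perturbedState _ hE, outcomeProb_perturbedState _ hE, h1, h1]
    have h2 : inner ℝ (vec (T.realBlock E ν)) (vec M)
        = √(T.realBlock E ν).trace * inner ℝ (scaledVec (T.realBlock E ν)) (vec M) := by
      conv_lhs => rw [(isEffect_realBlock hE ν).vec_eq]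
      rw [inner_smul_left]; simp
    have h3 : inner ℝ (vec (T.realBlock E ν)) (vec (0 : Matrix (Fin (T.dim ν)) (Fin (T.dim ν)) ℝ))
        = 0 := by
      rw [inner_vec]; simp
    rw [h2, h3]
    ring
  -- All other blocks contribute nonnegatively by admissibility, so the unperturbed block `ν` alone
  -- bounds the probability from below.
  have hlow : ∀ {E : Matrix T.Index T.Index ℂ}, E.PosSemidef →
      τ * (T.realBlock E ν).trace ≤ outcomeProb (T.perturbedState (Function.update N ν 0)) E := by
    intro E hE
    rw [outcomeProb_perturbedState _ hE]
    have h1 := Finset.single_le_sum (f := fun μ => ∑ i, T.a μ i * T.realBlock E μ i i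
      + T.eps μ * inner ℝ (vec (T.realBlock E μ)) (vec (Function.update N ν 0 μ)))
      (fun μ _ => block_nonneg hE (hup (isAdmissible_zero ν) μ)) (Finset.mem_univ ν)
    simp only [Function.update_self] at h1
    have h3 : inner ℝ (vec (T.realBlock E ν)) (vec (0 : Matrix (Fin (T.dim ν)) (Fin (T.dim ν)) ℝ))
        = 0 := by
      rw [inner_vec]; simp
    rw [h3, mul_zero, add_zero] at h1
    have h2 := (le_sum_diag hE ν).trans h1
    calc τ * (T.realBlock E ν).trace = 1 / T.d * (T.d * τ * (T.realBlock E ν).trace) := by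
          field_simp
      _ ≤ _ := by gcongr
  have hterm : ∀ {E : Matrix T.Index T.Index ℂ}, E.PosSemidef → ∀ t : ℝ,
      (T.eps ν / T.d * √(T.realBlock E ν).trace * t) ^ 2
        / outcomeProb (T.perturbedState (Function.update N ν 0)) E ≤ T.strength ν * t ^ 2 := by
    intro E hE t
    have h0 := (isEffect_realBlock hE ν).trace_nonneg
    rw [mul_pow, mul_pow, Real.sq_sqrt h0]
    have h1 := hlow hE
    rcases h0.eq_or_lt with h | h
    · rw [← h, mul_zero, zero_mul, zero_div]; positivity
    · rw [div_le_iff₀ ((mul_pos hτpos h).trans_le h1), hstr]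
      calc (T.eps ν / T.d) ^ 2 * (T.realBlock E ν).trace * t ^ 2
          = (T.eps ν / T.d) ^ 2 / τ * t ^ 2 * (τ * (T.realBlock E ν).trace) := by field_simp
        _ ≤ _ := by gcongr
  have hOut : ∀ {r : ℕ} (M : POVM T.Index r), Outcomes κ
      (fun z X => outcomeProb (T.perturbedState (Function.update N ν X)) (M.elem z))
      fun z => outcomeProb (T.perturbedState (Function.update N ν 0)) (M.elem z) := by
    intro r M
    refine ⟨fun z => measurable_outcomeProb (measurable_update N) _, fun z => ?_, ?_, fun z => ?_,
      ?_, fun z hz => ?_⟩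
    · filter_upwards [hae] with X hX
      exact outcomeProb_nonneg (hup hX.1) (M.posSemidef z)
    · filter_upwards [hae] with X hX
      exact sum_outcomeProb hdpos (fun μ => (hup hX.1 μ).1) M
    · exact outcomeProb_nonneg (hup (isAdmissible_zero ν)) (M.posSemidef z)
    · exact sum_outcomeProb hdpos (fun μ => (hup (isAdmissible_zero ν) μ).1) M
    · have h1 := hlow (M.posSemidef z)
      rw [hz] at h1
      have h2 : (T.realBlock (M.elem z) ν).trace = 0 :=
        le_antisymm (by nlinarith) (isEffect_realBlock (M.posSemidef z) ν).trace_nonneg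
      refine Filter.Eventually.of_forall fun X => ?_
      rw [hdiff (M.posSemidef z), hz, h2]; simp
  have hK : ∀ᵐ M ∂κ, ‖vec M‖ ≤ √(T.dim ν * (3 + C * √(Real.log m / T.dim ν)) ^ 2) :=
    hae.mono fun M h => h.2
  refine ⟨fun M => hOut M, fun M W hW => ?_, fun M W hW => ?_⟩
  · have hb := norm_sum_scaledVec_le (fun z => isEffect_realBlock (M.posSemidef z) ν)
      (sum_realBlock M ν)
    have h1 := hsub.sum_sq_integral_le (by positivity) hK _ hb hW
    have h2 : ∀ z, ∫ X, W X * outcomeProb (T.perturbedState (Function.update N ν X)) (M.elem z) ∂κ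
        - (∫ X, W X ∂κ) * outcomeProb (T.perturbedState (Function.update N ν 0)) (M.elem z)
        = T.eps ν / T.d * √(T.realBlock (M.elem z) ν).trace
          * ∫ X, W X * inner ℝ (scaledVec (T.realBlock (M.elem z) ν)) (vec X) ∂κ := by
      intro z
      rw [← integral_mul_const, ← integral_const_mul, ← integral_sub
        ((hOut M).isWeight_mul hW z).integrable (hW.integrable.mul_const _)]
      refine integral_congr_ae (Filter.Eventually.of_forall fun X => ?_)
      dsimp only
      rw [hdiff (M.posSemidef z)]
      ring
    simp_rw [h2]
    refine (Finset.sum_le_sum fun z _ => hterm (M.posSemidef z) _).trans ?_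
    rw [← Finset.mul_sum]
    calc _ ≤ T.strength ν * (4 * (2 / T.dim ν) * (∫ X, W X ∂κ) * entropy κ W) := by gcongr
      _ = _ := by ring
  · have hb := norm_sum_scaledVec_le (fun z => isEffect_realBlock (M.posSemidef z) ν)
      (sum_realBlock M ν)
    have htr := sum_norm_scaledVec_le (fun z => isEffect_realBlock (M.posSemidef z) ν)
      (sum_realBlock M ν)
    have h1 := hsub.integral_sum_sq_le (by positivity) hK _ hb hW
    have hmeas : Measurable fun X : Matrix (Fin (T.dim ν)) (Fin (T.dim ν)) ℝ =>
        ∑ z, inner ℝ (scaledVec (T.realBlock (M.elem z) ν)) (vec X) ^ 2 :=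
      Finset.measurable_sum _ fun z _ => (hsub.measurable _).pow_const 2
    have hint := hW.integrable_mul hmeas (K := ∑ z, (‖scaledVec (T.realBlock (M.elem z) ν)‖
        * √(T.dim ν * (3 + C * √(Real.log m / T.dim ν)) ^ 2)) ^ 2) (by
      filter_upwards [hK] with X hX
      rw [abs_of_nonneg (by positivity)]
      refine Finset.sum_le_sum fun z _ => ?_
      rw [← sq_abs]
      exact pow_le_pow_left₀ (abs_nonneg _)
        ((abs_real_inner_le_norm _ _).trans (by gcongr)) 2)
    have hP := hW.integral_nonneg
    calc ∫ X, W X * ∑ z, (outcomeProb (T.perturbedState (Function.update N ν X)) (M.elem z)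
            - outcomeProb (T.perturbedState (Function.update N ν 0)) (M.elem z)) ^ 2
            / outcomeProb (T.perturbedState (Function.update N ν 0)) (M.elem z) ∂κ
        ≤ ∫ X, T.strength ν * (W X
            * ∑ z, inner ℝ (scaledVec (T.realBlock (M.elem z) ν)) (vec X) ^ 2) ∂κ := by
          refine integral_mono_ae ?_ (hint.const_mul _) ?_
          · exact hW.integrable_mul (Finset.measurable_sum _ fun z _ =>
              ((((hOut M).measurable z).sub_const _).pow_const 2).div_const _)
              (hOut M).abs_sum_div_le
          · filter_upwards [hW.nonneg] with X hX
            rw [mul_left_comm]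
            refine mul_le_mul_of_nonneg_left ?_ hX
            rw [Finset.mul_sum]
            refine Finset.sum_le_sum fun z _ => ?_
            rw [hdiff (M.posSemidef z), add_sub_cancel_left]
            exact hterm (M.posSemidef z) _
      _ = T.strength ν * ∫ X, W X
            * ∑ z, inner ℝ (scaledVec (T.realBlock (M.elem z) ν)) (vec X) ^ 2 ∂κ :=
          integral_const_mul _ _
      _ ≤ T.strength ν * (8 * (2 / T.dim ν) * entropy κ W
            + 4 * (2 / T.dim ν) * T.dim ν * ∫ X, W X ∂κ) := by
          refine mul_le_mul_of_nonneg_left (h1.trans ?_) hstr0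
          gcongr
      _ = _ := by field_simp; ring

end Task

/-! ### The hybrid argument over the blocks -/

/-- If replacing any single coordinate by its random value costs at most `η`, then replacing all
coordinates of a finite set costs at most `η` times the number of coordinates. -/
theorem lmarginal_le_of_update_le {δ : Type*} [DecidableEq δ] {X : δ → Type*}
    [∀ i, MeasurableSpace (X i)] [∀ i, Zero (X i)] (μ : ∀ i, Measure (X i))
    [∀ i, IsProbabilityMeasure (μ i)] {f : (∀ i, X i) → ℝ≥0∞} (hf : Measurable f)
    {P : ∀ i, X i → Prop} (hP0 : ∀ i, P i 0) (hP : ∀ i, ∀ᵐ x ∂(μ i), P i x) {η : ℝ≥0∞}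
    (h : ∀ y, (∀ i, P i (y i)) → ∀ i,
      ∫⁻ x, f (Function.update y i x) ∂(μ i) ≤ f (Function.update y i 0) + η)
    (s : Finset δ) (y : ∀ i, X i) (hy : ∀ i, P i (y i)) :
    (∫⋯∫⁻_s, f ∂μ) y ≤ f (s.piecewise (0 : ∀ i, X i) y) + s.card * η := by
  induction s using Finset.induction_on generalizing y with
  | empty => simp
  | insert i s hi ih =>
    rw [lmarginal_insert f hf hi]
    have hgood : ∀ i, P i (s.piecewise (0 : ∀ i, X i) y i) := by
      intro k
      by_cases hk : k ∈ s
      · rw [Finset.piecewise_eq_of_mem _ _ _ hk]; exact hP0 k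
      · rw [Finset.piecewise_eq_of_notMem _ _ _ hk]; exact hy k
    calc ∫⁻ x, (∫⋯∫⁻_s, f ∂μ) (Function.update y i x) ∂(μ i)
        ≤ ∫⁻ x, (f (Function.update (s.piecewise (0 : ∀ i, X i) y) i x) + s.card * η) ∂(μ i) := by
          refine lintegral_mono_ae ?_
          filter_upwards [hP i] with x hx
          have h1 := ih (Function.update y i x) fun k => by
            by_cases hk : k = i
            · subst hk; simpa using hx
            · rw [Function.update_of_ne hk]; exact hy k
          -- Zeroing the coordinates in `s` commutes with changing `i ∉ s`, so after the induction
          -- hypothesis only coordinate `i` of the hybrid is random.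
          have h2 := Finset.update_piecewise_of_notMem s (0 : ∀ i, X i) y hi x
          rwa [← h2] at h1
      _ ≤ f (Function.update (s.piecewise (0 : ∀ i, X i) y) i 0) + η + s.card * η := by
          rw [lintegral_add_right _ measurable_const]
          simp only [lintegral_const, measure_univ, mul_one]
          gcongr
          exact h _ hgood i
      _ = f ((insert i s).piecewise (0 : ∀ i, X i) y) + (insert i s).card * η := by
          rw [Finset.card_insert_of_notMem hi, Finset.piecewise_insert]
          push_cast
          simp only [Pi.zero_apply]
          ring

/-! ### From the block bound to the number of copies -/

namespace Task

variable {m : ℕ} {T : Task m}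

theorem mul_strength_le (hd : 0 < T.d) (ν : Fin m) :
    (m : ℝ) * T.N * T.strength ν ≤ √(T.dim ν : ℝ) := by
  have hm : (0 : ℝ) < m := by exact_mod_cast T.one_le_m
  have hd' : (0 : ℝ) < T.d := by exact_mod_cast hd
  have h1 : (m : ℝ) * T.N ≤ √(T.dim ν : ℝ) * (T.d : ℝ) ^ 2 / (T.eps ν ^ 2 * (2 : ℝ) ^ T.j ν) := by
    rw [N, ← mul_assoc, mul_one_div_cancel hm.ne', one_mul]
    exact ciInf_le (Set.finite_range _).bddBelow ν
  have he := T.eps_pos ν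
  calc (m : ℝ) * T.N * T.strength ν
      ≤ √(T.dim ν : ℝ) * (T.d : ℝ) ^ 2 / (T.eps ν ^ 2 * (2 : ℝ) ^ T.j ν) * T.strength ν := by
        gcongr
        rw [strength]; positivity
    _ = √(T.dim ν : ℝ) := by rw [strength]; field_simp

/-- The definition of `N` gives `n · strength ν ≤ √d_ν / (200 m)`. Hence `3αβn² = 192 (n · strength
ν)² / d_ν` is at most `s²` for `s = 1 / (12 m)`, and the advantage `2s` is the share of one block.
-/
theorem integral_update_le {C : ℝ} (hC : 0 ≤ C) (ν : Fin m) (hdim : 50 ≤ T.dim ν)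
    {N : (ν : Fin m) → Matrix (Fin (T.dim ν)) (Fin (T.dim ν)) ℝ}
    (hN : ∀ μ, T.IsAdmissible μ (N μ))
    (hU : T.eps ν * (3 + C * √(Real.log m / T.dim ν)) ≤ T.d * (2 : ℝ) ^ (-T.j ν)) {n : ℕ}
    (hn : (n : ℝ) ≤ 1 / 200 * T.N) (alg : IncoherentAlgorithm T.Index n) :
    ∫⁻ M, ENNReal.ofReal (alg.decisionProb (T.perturbedState (Function.update N ν M)) true)
        ∂(goeStarTrunc (T.dim ν) (truncEvent C m (T.dim ν)))
      ≤ ENNReal.ofReal (alg.decisionProb (T.perturbedState (Function.update N ν 0)) true)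
        + ENNReal.ofReal (1 / (6 * m)) := by
  have hm : (1 : ℝ) ≤ m := by exact_mod_cast T.one_le_m
  have hD : (50 : ℝ) ≤ T.dim ν := by exact_mod_cast hdim
  have hdpos : 0 < T.d :=
    (by omega : 0 < T.dim ν).trans_le
      (Finset.single_le_sum (f := T.dim) (fun _ _ => Nat.zero_le _) (Finset.mem_univ ν))
  have := isProbabilityMeasure_goeStarTrunc hC m hdim
  have hstep := stepBound hC ν hdim hN hU
  have hs0 : 0 ≤ T.strength ν := by rw [strength]; positivity
  set κ := T.strength ν with hκ
  set D : ℝ := ((T.dim ν : ℕ) : ℝ) with hDdef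
  have hDpos : 0 < D := by linarith
  have hnκ : n * κ ≤ √D / (200 * m) := by
    have h1 := mul_strength_le hdpos ν
    rw [le_div_iff₀ (by positivity)]
    calc n * κ * (200 * m) ≤ 1 / 200 * T.N * κ * (200 * m) := by gcongr
      _ = m * T.N * κ := by ring
      _ ≤ √D := h1
  have hnκ2 : (n * κ) ^ 2 ≤ D / (40000 * m ^ 2) := by
    calc (n * κ) ^ 2 ≤ (√D / (200 * m)) ^ 2 := by gcongr
      _ = D / (40000 * m ^ 2) := by
        rw [div_pow, Real.sq_sqrt hDpos.le]; congr 1; ring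
  have hnon : ∀ M : Matrix (Fin (T.dim ν)) (Fin (T.dim ν)) ℝ, T.IsAdmissible ν M →
      ∀ μ, T.IsAdmissible μ (Function.update N ν M μ) := by
    intro M hM μ
    by_cases h : μ = ν
    · subst h; simpa using hM
    · rw [Function.update_of_ne h]; exact hN μ
  have h₀ : alg.decisionProb (T.perturbedState (Function.update N ν 0)) true ∈ Set.Icc (0 : ℝ) 1 :=
    IncoherentAlgorithm.decisionProb_mem
      (fun M z => outcomeProb_nonneg (hnon 0 (isAdmissible_zero ν)) (M.posSemidef z))
      (fun M => sum_outcomeProb hdpos (fun μ => (hnon 0 (isAdmissible_zero ν) μ).1) M) true alg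
  have hρ : ∀ E : Matrix T.Index T.Index ℂ,
      Measurable fun M => outcomeProb (T.perturbedState (Function.update N ν M)) E := fun E =>
    measurable_outcomeProb (measurable_update N) E
  have hmain := hstep.integral_decisionProb_le (s := 1 / (12 * m)) (by positivity) (by positivity)
    hρ true (by positivity) (by rw [div_le_one (by positivity)]; linarith) alg ?_ ?_ h₀
  · have hmem := IncoherentAlgorithm.decisionProb_mem_ae hstep.outcomes true alg
    rw [← ofReal_integral_eq_lintegral_ofReal, ← ENNReal.ofReal_add h₀.1 (by positivity)]
    · refine ENNReal.ofReal_le_ofReal (hmain.trans (le_of_eq ?_))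
      field_simp; ring
    · refine Integrable.of_bound
        (IncoherentAlgorithm.measurable_decisionProb hρ true alg).aestronglyMeasurable 1 ?_
      filter_upwards [hmem] with x hx
      rw [Real.norm_eq_abs, abs_of_nonneg hx.1]
      exact hx.2
    · filter_upwards [hmem] with x hx using hx.1
  · have h1 : n * κ ≤ D / 200 := by
      refine hnκ.trans ?_
      rw [div_le_div_iff₀ (by positivity) (by norm_num)]
      have : √D ≤ D := by
        rw [Real.sqrt_le_left hDpos.le]; nlinarith
      nlinarith
    calc 3 * n * (8 * κ / D) = 24 * (n * κ) / D := by ring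
      _ ≤ 1 := by rw [div_le_one hDpos]; linarith
  · calc 3 * (8 * κ / D) * (8 * κ) * n ^ 2 = 192 * (n * κ) ^ 2 / D := by ring
      _ ≤ 192 * (D / (40000 * m ^ 2)) / D := by gcongr
      _ = 192 / 40000 * (1 / m ^ 2) := by field_simp
      _ ≤ 1 / 144 * (1 / m ^ 2) := mul_le_mul_of_nonneg_right (by norm_num) (by positivity)
      _ = (1 / (12 * m)) ^ 2 := by field_simp; norm_num

theorem nullState_eq : T.nullState = T.perturbedState 0 := by
  simp [nullState, perturbedState]

/-- The null state is the hybrid with every block zero. A correct algorithm accepts it with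
probability at most `1 / 3`, and `m` blocks at `1 / (6 m)` each cannot lift this beyond `1 / 2`. -/
theorem lt_of_distinguishes {C : ℝ} (hC : 0 ≤ C) (hdim : ∀ ν, 50 ≤ T.dim ν)
    (hU : ∀ ν, T.eps ν * (3 + C * √(Real.log m / T.dim ν)) ≤ T.d * (2 : ℝ) ^ (-T.j ν)) {n : ℕ}
    (alg : IncoherentAlgorithm T.Index n) (h : T.Distinguishes C alg) :
    1 / 200 * T.N < n := by
  by_contra! hn
  have hm : (1 : ℝ) ≤ m := by exact_mod_cast T.one_le_m
  have hdpos : 0 < T.d := by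
    have := hdim ⟨0, T.one_le_m⟩
    exact (by omega : 0 < T.dim ⟨0, T.one_le_m⟩).trans_le
      (Finset.single_le_sum (f := T.dim) (fun _ _ => Nat.zero_le _) (Finset.mem_univ _))
  have : ∀ ν, IsProbabilityMeasure (goeStarTrunc (T.dim ν) (truncEvent C m (T.dim ν))) :=
    fun ν => isProbabilityMeasure_goeStarTrunc hC m (hdim ν)
  set f : ((ν : Fin m) → Matrix (Fin (T.dim ν)) (Fin (T.dim ν)) ℝ) → ℝ :=
    fun M => alg.decisionProb (T.perturbedState M) true with hf
  have hfm : Measurable f :=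
    IncoherentAlgorithm.measurable_decisionProb (fun E => measurable_outcomeProb measurable_id E)
      true alg
  have hP : ∀ ν, ∀ᵐ M ∂(goeStarTrunc (T.dim ν) (truncEvent C m (T.dim ν))),
      T.IsAdmissible ν M := by
    intro ν
    filter_upwards [goeStarTrunc_ae C m (hdim ν)] with M hM
    exact ⟨hM.1, (mul_le_mul_of_nonneg_left hM.2 (T.eps_pos ν).le).trans (hU ν)⟩
  have hmarg := lmarginal_le_of_update_le
    (fun ν => goeStarTrunc (T.dim ν) (truncEvent C m (T.dim ν)))
    (f := fun M => ENNReal.ofReal (f M)) (ENNReal.measurable_ofReal.comp hfm)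
    (P := fun ν => T.IsAdmissible ν) isAdmissible_zero hP
    (fun y hy ν => integral_update_le hC ν (hdim ν) hy (hU ν) hn alg) Finset.univ 0
    isAdmissible_zero
  rw [lmarginal_univ, Finset.piecewise_univ, Finset.card_univ, Fintype.card_fin] at hmarg
  have h0 := IncoherentAlgorithm.decisionProb_add (ρ := T.nullState) (fun M => by
    rw [nullState_eq]; exact sum_outcomeProb hdpos (fun ν => (isAdmissible_zero ν).1) M) alg
  have hf0 : f 0 ≤ 1 / 3 := by
    have h1 := h.1
    rw [hf]; dsimp only
    rw [← nullState_eq]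
    linarith
  have h2 : (2 / 3 : ℝ) ≤ ∫ M, f M ∂(T.perturbationLaw C) := h.2
  have h3 : ∫ M, f M ∂(T.perturbationLaw C) ≤ 1 / 2 := by
    refine (le_abs_self _).trans ?_
    have hae : ∀ᵐ M ∂(T.perturbationLaw C), 0 ≤ f M := by
      have hall : ∀ᵐ M ∂(T.perturbationLaw C), ∀ ν, T.IsAdmissible ν (M ν) :=
        ae_all_iff.2 fun ν => (Measure.quasiMeasurePreserving_eval
          (fun ν => goeStarTrunc (T.dim ν) (truncEvent C m (T.dim ν))) ν).ae (hP ν)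
      filter_upwards [hall] with M hM
      exact (IncoherentAlgorithm.decisionProb_mem (fun P z => outcomeProb_nonneg hM (P.posSemidef z))
        (fun P => sum_outcomeProb hdpos (fun μ => (hM μ).1) P) true alg).1
    rw [abs_of_nonneg (integral_nonneg_of_ae hae),
      integral_eq_lintegral_of_nonneg_ae hae hfm.aestronglyMeasurable]
    refine ENNReal.toReal_le_of_le_ofReal (by norm_num) (hmarg.trans ?_)
    have h4 : (m : ℝ≥0∞) * ENNReal.ofReal (1 / (6 * m)) = ENNReal.ofReal (1 / 6) := by
      rw [← ENNReal.ofReal_natCast, ← ENNReal.ofReal_mul (by positivity)]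
      congr 1; field_simp
    rw [h4]
    calc ENNReal.ofReal (f 0) + ENNReal.ofReal (1 / 6)
        ≤ ENNReal.ofReal (1 / 3) + ENNReal.ofReal (1 / 6) := by gcongr
      _ = ENNReal.ofReal (1 / 2) := by
        rw [← ENNReal.ofReal_add (by norm_num) (by norm_num)]; norm_num
  linarith

end Task

end

end BlockTask

/-- There are absolute constants such that distinguishing the two hypotheses of every multi-block
task with incoherent measurements needs at least `c N / log^k (N + 2)` copies. -/
theorem mainTheorem5 :
    ∃ (aStar k : ℕ) (C C' c : ℝ), 0 < C ∧ 0 < C' ∧ 0 < c ∧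
      ∀ (m : ℕ) (T : BlockTask.Task m),
        1 / T.epsTotal ≤ T.N →
        (∀ ν, aStar ≤ T.dim ν) →
        (∀ ν, T.eps ν ≤
          (T.d : ℝ) * (2 : ℝ) ^ (-T.j ν) / (12 + C' * √(Real.log m / T.dim ν))) →
        (∀ ν, 2 * T.epsTotal / Real.log (T.d / T.epsTotal) ≤ (T.dim ν : ℝ) / (2 : ℝ) ^ T.j ν) →
        ∀ (n : ℕ) (alg : BlockTask.IncoherentAlgorithm T.Index n),
          T.Distinguishes C alg →
          c * T.N / Real.log (T.N + 2) ^ k ≤ n := by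
  -- The dimension `50` is what the two tail bounds need, and `k = 0` since no logarithm is lost.
  -- With `C = 1` and `C' = 4` the assumed bound on `ε_ν` is four times stronger than admissibility
  -- of the truncated perturbations requires, as `12 + 4x = 4 (3 + x)`.
  refine ⟨50, 0, 1, 4, 1 / 200, one_pos, by norm_num, by norm_num, ?_⟩
  intro m T _ hdim heps _ n alg halg
  rw [pow_zero, div_one]
  refine (BlockTask.Task.lt_of_distinguishes zero_le_one hdim (fun ν => ?_) alg halg).le
  have h1 : 0 ≤ √(Real.log m / T.dim ν) := Real.sqrt_nonneg _
  have h2 := heps ν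
  rw [le_div_iff₀ (by positivity)] at h2
  have h3 := mul_nonneg (T.eps_pos ν).le h1
  have h4 := T.eps_pos ν
  nlinarith
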